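/- Let $\tau\in\mathbb C$ with $\operatorname{Im}\tau>0$ and let $\theta_1(t)=-\sum_{j\in\mathbb Z}e^{\pi i(j+\frac12)^2\tau+2\pi i(j+\frac12)(t+\frac12)}$ and $\sigma(w,t)=\dfrac{\theta_1(w-t)\,\theta_1'(0)}{\theta_1(w)\,\theta_1(t)}$. Setting. Let $\mathfrak h$ be the complexification of a Euclidean space, i.e. a finite dimensional complex vector space with a nondegenerate symmetric bilinear form $(\cdot,\cdot)$, regarded as an abelian Lie algebra, and let $V=\bigoplus_{\mu\in\mathfrak h}V[\mu]$ be a finite dimensional diagonalizable $\mathfrak h$-module, where $x\in\mathfrak h$ acts on $V[\mu]$ as the scalar $(\mu,x)$. Let $P_\mu\in\operatorname{End}(V)$ be the projection onto $V[\mu]$ along the other weight spaces. Write $X^{(j)}$ for $X\in\operatorname{End}(V)$ acting on the $j$-th tensor factor, and $A^{(ij)}$ for $A\in\operatorname{End}(V\otimes V)$ acting on the $i$-th and $j$-th factors (in this order). For a meromorphic function $f$ on $\mathfrak h$ with values in $\operatorname{End}(V\otimes V\otimes V)$ and $\eta\in\mathbb C$ put $f(\lambda+\eta h^{(k)})=\sum_{\mu}P_\mu^{(k)}f(\lambda+\eta\mu)$.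 A meromorphic function $R(z,\lambda)$ of $(z,\lambda)\in\mathbb C\times\mathfrak h$ with values in $\operatorname{End}(V\otimes V)$ is a *generalized quantum $R$-matrix* with parameter $\eta$ if, as identities of meromorphic functions, with $z_{ij}=z_i-z_j$, 1. (modified Yang–Baxter equation) $$R^{(12)}(z_{12},\lambda+\eta h^{(3)})\,R^{(13)}(z_{13},\lambda-\eta h^{(2)})\,R^{(23)}(z_{23},\lambda+\eta h^{(1)})=R^{(23)}(z_{23},\lambda-\eta h^{(1)})\,R^{(13)}(z_{13},\lambda+\eta h^{(2)})\,R^{(12)}(z_{12},\lambda-\eta h^{(3)});$$ 2. (unitarity) $R^{(12)}(z_{12},\lambda)\,R^{(21)}(z_{21},\lambda)=\mathrm{Id}_{V\otimes V}$; 3. (weight zero) $[X^{(1)}+X^{(2)},R(z,\lambda)]=0$ for all $X\in\mathfrak h$. Proposition. Let $\mathfrak h$ be the abelian Lie algebra of diagonal $N\times N$ complex matrices $\lambda=\operatorname{diag}(\lambda_1,\dots,\lambda_N)$ with bilinear form $\operatorname{Trace}(AB)$, acting on $V=\mathbb C^N$; let $E_{ij}$ be the matrix units and $\lambda_{ij}=\lambda_i-\lambda_j$.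 Let $\gamma\in\mathbb C\setminus(\mathbb Z+\tau\mathbb Z)$. Then $$R(z,\lambda)=\sum_iE_{ii}\otimes E_{ii}+\sum_{i\ne j}\frac{\sigma(\gamma,\lambda_{ij})}{\sigma(\gamma,z)}E_{ii}\otimes E_{jj}+\sum_{i\ne j}\frac{\sigma(\lambda_{ij},z)}{\sigma(\gamma,z)}E_{ij}\otimes E_{ji}$$ is a (meromorphic) generalized quantum $R$-matrix with parameter $\eta=\gamma/2$. -/

import Mathlib

open Topology TensorProduct

noncomputable section

namespace EllipticR

/-! ### Theta functions -/

/-- Jacobi's theta function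
`θ₁(t|τ) = -∑_{j ∈ ℤ} exp (π i (j + 1/2)² τ + 2 π i (j + 1/2) (t + 1/2))` (for `Im τ > 0`). -/
def theta1 (τ t : ℂ) : ℂ :=
  -∑' j : ℤ, Complex.exp (Real.pi * Complex.I * ((j : ℂ) + 1 / 2) ^ 2 * τ
    + 2 * Real.pi * Complex.I * ((j : ℂ) + 1 / 2) * (t + 1 / 2))

/-- `σ(w,t) = θ₁(w - t) θ₁'(0) / (θ₁(w) θ₁(t))`. -/
def sigma (τ w t : ℂ) : ℂ :=
  theta1 τ (w - t) * deriv (theta1 τ) 0 / (theta1 τ w * theta1 τ t)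

/-! ### Meromorphic functions of several variables

A meromorphic function is represented by a total function whose values off its domain of
holomorphy are irrelevant.  Identities between meromorphic functions are required at every point
at which all the functions in them are holomorphic; these points form a dense open set. -/

/-- `F` is meromorphic on `E`: near each point it is a quotient `f / g` of holomorphic functions,
with `g` not identically zero near that point. -/
def IsMeromorphic {E : Type*} [NormedAddCommGroup E] [NormedSpace ℂ E] (F : E → ℂ) : Prop :=
  ∀ p : E, ∃ f g : E → ℂ, AnalyticAt ℂ f p ∧ AnalyticAt ℂ g p ∧ (∃ᶠ x in 𝓝 p, g x ≠ 0) ∧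
    ∀ᶠ x in 𝓝 p, g x ≠ 0 → F x = f x / g x

section RMatrix

variable {H V : Type*} [NormedAddCommGroup H] [NormedSpace ℂ H]
  [AddCommGroup V] [Module ℂ V]

/-! ### Weight decompositions -/

/-- The weight space `V[μ]`: the vectors on which each `x : H` acts as the scalar `(μ, x)`. -/
def weightSpace (B : LinearMap.BilinForm ℂ H) (ρ : H →ₗ[ℂ] Module.End ℂ V) (μ : H) :
    Submodule ℂ V :=
  ⨅ x : H, LinearMap.ker (ρ x - B μ x • (1 : Module.End ℂ V))

open Classical in
/-- The projection `P_μ` of a diagonalizable module onto `V[μ]`, along the sum of the other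
weight spaces. -/
def weightProj (B : LinearMap.BilinForm ℂ H) (ρ : H →ₗ[ℂ] Module.End ℂ V) (μ : H) :
    Module.End ℂ V :=
  if h : IsCompl (weightSpace B ρ μ) (⨆ (ν : H) (_ : ν ≠ μ), weightSpace B ρ ν) then
    (weightSpace B ρ μ).projection (⨆ (ν : H) (_ : ν ≠ μ), weightSpace B ρ ν) h
  else 0

/-! ### Leg notation -/

/-- `X^{(1)}` on `V ⊗ V ⊗ V`. -/
def op1 (X : Module.End ℂ V) : Module.End ℂ (V ⊗[ℂ] (V ⊗[ℂ] V)) :=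
  X.rTensor (V ⊗[ℂ] V)

/-- `X^{(2)}` on `V ⊗ V ⊗ V`. -/
def op2 (X : Module.End ℂ V) : Module.End ℂ (V ⊗[ℂ] (V ⊗[ℂ] V)) :=
  (X.rTensor V).lTensor V

/-- `X^{(3)}` on `V ⊗ V ⊗ V`. -/
def op3 (X : Module.End ℂ V) : Module.End ℂ (V ⊗[ℂ] (V ⊗[ℂ] V)) :=
  (X.lTensor V).lTensor V

/-- `A^{(21)}` on `V ⊗ V`, that is, `P A P` with `P` the flip. -/
def leg21 (A : Module.End ℂ (V ⊗[ℂ] V)) : Module.End ℂ (V ⊗[ℂ] V) :=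
  (TensorProduct.comm ℂ V V).conj A

/-- `A^{(12)}` on `V ⊗ V ⊗ V`. -/
def leg12 (A : Module.End ℂ (V ⊗[ℂ] V)) : Module.End ℂ (V ⊗[ℂ] (V ⊗[ℂ] V)) :=
  (TensorProduct.assoc ℂ V V V).conj (A.rTensor V)

/-- `A^{(23)}` on `V ⊗ V ⊗ V`. -/
def leg23 (A : Module.End ℂ (V ⊗[ℂ] V)) : Module.End ℂ (V ⊗[ℂ] (V ⊗[ℂ] V)) :=
  A.lTensor V

/-- `A^{(13)}` on `V ⊗ V ⊗ V`: the conjugate of `A^{(12)}` by the flip of the last two factors. -/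
def leg13 (A : Module.End ℂ (V ⊗[ℂ] V)) : Module.End ℂ (V ⊗[ℂ] (V ⊗[ℂ] V)) :=
  ((TensorProduct.comm ℂ V V).lTensor V).conj (leg12 A)

/-- `f(λ + η h^{(k)}) = ∑_μ P_μ^{(k)} f(λ + η μ)`; here `op` is `X ↦ X^{(k)}`.  Only the finitely
many weights of `V` contribute. -/
def dynShift (B : LinearMap.BilinForm ℂ H) (ρ : H →ₗ[ℂ] Module.End ℂ V)
    (op : Module.End ℂ V → Module.End ℂ (V ⊗[ℂ] (V ⊗[ℂ] V))) (η : ℂ)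
    (f : H → Module.End ℂ (V ⊗[ℂ] (V ⊗[ℂ] V))) (l : H) :
    Module.End ℂ (V ⊗[ℂ] (V ⊗[ℂ] V)) :=
  ∑ᶠ μ : H, op (weightProj B ρ μ) * f (l + η • μ)

/-! ### Generalized quantum R-matrices -/

/-- `R` is holomorphic at `(z, l)`: all its matrix elements are. -/
def IsRegularAt (R : ℂ → H → Module.End ℂ (V ⊗[ℂ] V)) (z : ℂ) (l : H) : Prop :=
  ∀ φ : Module.Dual ℂ (Module.End ℂ (V ⊗[ℂ] V)),
    AnalyticAt ℂ (fun p : ℂ × H => φ (R p.1 p.2)) (z, l)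

/-- `R(z, l)` is a generalized quantum R-matrix with parameter `η`, for the abelian Lie algebra `H`
with complex bilinear form `B`, acting on `V` by `ρ`. -/
structure IsGeneralizedQuantumRMatrix (B : LinearMap.BilinForm ℂ H)
    (ρ : H →ₗ[ℂ] Module.End ℂ V) (η : ℂ) (R : ℂ → H → Module.End ℂ (V ⊗[ℂ] V)) : Prop where
  finiteDimensional_H : FiniteDimensional ℂ H
  finiteDimensional_V : FiniteDimensional ℂ V
  /-- `H` with its form is the complexification of a Euclidean space. -/
  form_symm : B.IsSymm
  form_nondegenerate : B.Nondegenerate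
  /-- `V` is a diagonalizable module. -/
  diagonalizable : ⨆ μ : H, weightSpace B ρ μ = ⊤
  meromorphic : ∀ φ : Module.Dual ℂ (Module.End ℂ (V ⊗[ℂ] V)),
    IsMeromorphic (fun p : ℂ × H => φ (R p.1 p.2))
  /-- The modified (dynamical) Yang--Baxter equation, with `z_{ij} = z_i - z_j`. -/
  yangBaxter : ∀ (z₁ z₂ z₃ : ℂ) (l : H),
    (∀ μ : H, weightSpace B ρ μ ≠ ⊥ →
      ∀ z ∈ ({z₁ - z₂, z₁ - z₃, z₂ - z₃} : Set ℂ),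
        IsRegularAt R z (l + η • μ) ∧ IsRegularAt R z (l + (-η) • μ)) →
    dynShift B ρ op3 η (fun m => leg12 (R (z₁ - z₂) m)) l *
      dynShift B ρ op2 (-η) (fun m => leg13 (R (z₁ - z₃) m)) l *
      dynShift B ρ op1 η (fun m => leg23 (R (z₂ - z₃) m)) l =
    dynShift B ρ op1 (-η) (fun m => leg23 (R (z₂ - z₃) m)) l *
      dynShift B ρ op2 η (fun m => leg13 (R (z₁ - z₃) m)) l *
      dynShift B ρ op3 (-η) (fun m => leg12 (R (z₁ - z₂) m)) l
  /-- `R^{(12)}(z_{12}, l) R^{(21)}(z_{21}, l) = Id`. -/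
  unitarity : ∀ (z₁ z₂ : ℂ) (l : H), IsRegularAt R (z₁ - z₂) l → IsRegularAt R (z₂ - z₁) l →
    R (z₁ - z₂) l * leg21 (R (z₂ - z₁) l) = 1
  /-- `[X^{(1)} + X^{(2)}, R(z, l)] = 0` for all `X ∈ H`. -/
  weightZero : ∀ (X : H) (z : ℂ) (l : H), IsRegularAt R z l →
    Commute ((ρ X).rTensor V + (ρ X).lTensor V) (R z l)

end RMatrix

/-! ### Diagonal matrices and the elliptic R-matrix -/

/-- The action of diagonal `N × N` matrices on `ℂ^N`; `l : Fin N → ℂ` stands for the matrix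
`diag(l_1, …, l_N)`. -/
def diagAction (N : ℕ) : (Fin N → ℂ) →ₗ[ℂ] Module.End ℂ (Fin N → ℂ) :=
  (Matrix.toLin' (R := ℂ) (m := Fin N) (n := Fin N)).toLinearMap ∘ₗ
    Matrix.diagonalLinearMap (Fin N) ℂ ℂ

/-- The form `Trace(A B)` on diagonal matrices. -/
def diagTraceForm (N : ℕ) : LinearMap.BilinForm ℂ (Fin N → ℂ) :=
  ((LinearMap.mul ℂ (Matrix (Fin N) (Fin N) ℂ)).compr₂
    (Matrix.traceLinearMap (Fin N) ℂ ℂ)).compl₁₂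
      (Matrix.diagonalLinearMap (Fin N) ℂ ℂ) (Matrix.diagonalLinearMap (Fin N) ℂ ℂ)

theorem diagAction_apply (N : ℕ) (l : Fin N → ℂ) :
    diagAction N l = Matrix.toLin' (Matrix.diagonal l) := rfl

theorem diagTraceForm_apply (N : ℕ) (a b : Fin N → ℂ) :
    diagTraceForm N a b = (Matrix.diagonal a * Matrix.diagonal b).trace := rfl

/-- The endomorphism `E_{ij}` of `ℂ^N`. -/
def matE (N : ℕ) (i j : Fin N) : Module.End ℂ (Fin N → ℂ) :=
  Matrix.toLin' (Matrix.single i j (1 : ℂ))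

/-- The elliptic R-matrix
`∑_i E_ii ⊗ E_ii + ∑_{i ≠ j} (σ(γ,l_ij) / σ(γ,z)) E_ii ⊗ E_jj
  + ∑_{i ≠ j} (σ(l_ij,z) / σ(γ,z)) E_ij ⊗ E_ji`, with `l_ij = l_i - l_j`. -/
def ellipticR (N : ℕ) (τ γ z : ℂ) (l : Fin N → ℂ) :
    Module.End ℂ ((Fin N → ℂ) ⊗[ℂ] (Fin N → ℂ)) :=
  (∑ i, TensorProduct.map (matE N i i) (matE N i i))
  + (∑ i, ∑ j ∈ Finset.univ.filter (fun j => i ≠ j),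
      (sigma τ γ (l i - l j) / sigma τ γ z) • TensorProduct.map (matE N i i) (matE N j j))
  + (∑ i, ∑ j ∈ Finset.univ.filter (fun j => i ≠ j),
      (sigma τ (l i - l j) z / sigma τ γ z) • TensorProduct.map (matE N i j) (matE N j i))

end EllipticR

end

noncomputable section

namespace EllipticR

/-! ### Theta functions -/

/-! Everything rests on Weierstrass's three-term identity for θ₁. A product θ₁(x+y)θ₁(x-y) is a 2×2
determinant E(x)O(y) - O(x)E(y) in theta functions of modulus 2τ (`theta1_mul_theta1`), so the
identity is the Plücker relation between such determinants (`weierstrass_identity`). The same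
formulas give the oddness of θ₁, θ₁'(0) ≠ 0 (`deriv_theta1_zero_ne_zero`) and the location of the
zeros in ℤ + τℤ (`theta1_eq_zero`), without contour integrals. The last fact is how the assumption
on γ enters: θ₁(γ) ≠ 0.

R sends e_i ⊗ e_j into the span of e_i ⊗ e_j and e_j ⊗ e_i, so both sides of the Yang–Baxter
equation send e_a ⊗ e_b ⊗ e_c to combinations of its permutations. For distinct a, b, c each shift
is along the third index and leaves the difference of the other two coordinates alone; η plays no
role, and coefficients agree by `exch_three_term` and `exch_four_term`. When exactly two indices
coincide, the shifts by ±γ/2 produce the arguments x and x - γ, and the value η = γ/2 is what lets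
the three-term identity close up (`double_exch`, `mixed_exch_left`, `mixed_exch_right`,
`exch_middle`). Unitarity is the analogous computation on 2×2 blocks.

These computations need nonvanishing theta values. Every regular point is a limit, along a line, of
points where they hold, and both sides are continuous there, so the identities extend
(`yangBaxterAt_regular`, `unitarity_regular`). -/

theorem theta1_eq_jacobiTheta₂ (τ t : ℂ) :
    theta1 τ t = -(Complex.exp (Real.pi * Complex.I * (τ / 4 + t + 1 / 2)) *
      jacobiTheta₂ (t + 1 / 2 + τ / 2) τ) := by
  unfold theta1 jacobiTheta₂
  rw [← tsum_mul_left]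
  congr 2 with j
  rw [jacobiTheta₂_term, ← Complex.exp_add]
  congr 1
  ring

theorem differentiable_theta1 {τ : ℂ} (hτ : 0 < τ.im) : Differentiable ℂ (theta1 τ) := by
  have h : theta1 τ = fun t => -(Complex.exp (Real.pi * Complex.I * (τ / 4 + t + 1 / 2)) *
      jacobiTheta₂ (t + 1 / 2 + τ / 2) τ) := funext fun t => theta1_eq_jacobiTheta₂ τ t
  rw [h]
  have h2 : Differentiable ℂ (fun t : ℂ => jacobiTheta₂ (t + 1 / 2 + τ / 2) τ) := by
    intro t
    exact (differentiableAt_jacobiTheta₂_fst _ hτ).comp t (f := fun t => t + 1 / 2 + τ / 2)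
      (by fun_prop)
  exact (Differentiable.mul (by fun_prop) h2).neg

theorem theta1_add_one (τ t : ℂ) : theta1 τ (t + 1) = -theta1 τ t := by
  rw [theta1_eq_jacobiTheta₂, theta1_eq_jacobiTheta₂,
    show t + 1 + 1 / 2 + τ / 2 = (t + 1 / 2 + τ / 2) + 1 by ring, jacobiTheta₂_add_left,
    show Real.pi * Complex.I * (τ / 4 + (t + 1) + 1 / 2)
      = Real.pi * Complex.I * (τ / 4 + t + 1 / 2) + Real.pi * Complex.I by ring,
    Complex.exp_add, Complex.exp_pi_mul_I]
  ring

theorem theta1_add_tau (τ t : ℂ) :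
    theta1 τ (t + τ) = -(Complex.exp (-(Real.pi * Complex.I * (τ + 2 * t))) * theta1 τ t) := by
  rw [theta1_eq_jacobiTheta₂, theta1_eq_jacobiTheta₂,
    show t + τ + 1 / 2 + τ / 2 = (t + 1 / 2 + τ / 2) + τ by ring, jacobiTheta₂_add_left',
    show Real.pi * Complex.I * (τ / 4 + (t + τ) + 1 / 2)
      = Real.pi * Complex.I * (τ / 4 + t + 1 / 2) + Real.pi * Complex.I * τ by ring,
    show -Real.pi * Complex.I * (τ + 2 * (t + 1 / 2 + τ / 2)) =
      -(Real.pi * Complex.I * (τ + 2 * t)) + -(Real.pi * Complex.I * τ) + -(Real.pi * Complex.I)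
      by ring, Complex.exp_add, Complex.exp_add, Complex.exp_add, Complex.exp_neg (Real.pi * Complex.I),
    Complex.exp_pi_mul_I, Complex.exp_neg (Real.pi * Complex.I * τ)]
  field_simp [Complex.exp_ne_zero]

/-- The even part of the double theta series. -/
def evenTheta (τ x : ℂ) : ℂ := jacobiTheta₂ (2 * x) (2 * τ)

/-- The odd part of the double theta series. -/
def oddTheta (τ x : ℂ) : ℂ :=
  Complex.exp (Real.pi * Complex.I * (τ / 2 + 2 * x)) * jacobiTheta₂ (2 * x + τ) (2 * τ)

/-- The general term of the series of `theta1`. -/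
def theta1Term (τ t : ℂ) (j : ℤ) : ℂ :=
  Complex.exp (Real.pi * Complex.I * ((j : ℂ) + 1 / 2) ^ 2 * τ
    + 2 * Real.pi * Complex.I * ((j : ℂ) + 1 / 2) * (t + 1 / 2))

theorem hasSum_theta1Term {τ : ℂ} (hτ : 0 < τ.im) (t : ℂ) :
    HasSum (theta1Term τ t) (-theta1 τ t) := by
  rw [theta1_eq_jacobiTheta₂, neg_neg]
  convert! (hasSum_jacobiTheta₂_term (t + 1 / 2 + τ / 2) hτ).mul_left
    (Complex.exp (Real.pi * Complex.I * (τ / 4 + t + 1 / 2))) using 2 with j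
  rw [jacobiTheta₂_term, ← Complex.exp_add, theta1Term]
  congr 1
  ring

/-- Pairs of integers, split according to the parity of their sum. -/
def latticeSplit : (ℤ × ℤ) ⊕ (ℤ × ℤ) ≃ ℤ × ℤ where
  toFun
    -- For the half-integers j + 1/2 and k + 1/2, the sum and difference are 2p and 2q + 1 in this
    -- case, 2p + 1 and 2q in the other.
    | Sum.inl p => (p.1 + p.2, p.1 - p.2 - 1)
    | Sum.inr p => (p.1 + p.2, p.1 - p.2)
  invFun p := if (p.1 + p.2) % 2 = 0 then Sum.inr ((p.1 + p.2) / 2, (p.1 - p.2) / 2)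
    else Sum.inl ((p.1 + p.2 + 1) / 2, (p.1 - p.2 - 1) / 2)
  left_inv := by
    rintro (⟨p, q⟩ | ⟨p, q⟩)
    · dsimp only
      split_ifs
      · omega
      · simp only [Sum.inl.injEq, Prod.mk.injEq]
        omega
    · dsimp only
      split_ifs
      · simp only [Sum.inr.injEq, Prod.mk.injEq]
        omega
      · omega
  right_inv := by
    rintro ⟨j, k⟩
    dsimp only
    split_ifs <;> simp only [Prod.mk.injEq] <;> omega

theorem hasSum_mul_int {f g : ℤ → ℂ} {a b : ℂ} (hf : HasSum f a) (hg : HasSum g b) :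
    HasSum (fun p : ℤ × ℤ => f p.1 * g p.2) (a * b) :=
  hf.mul hg (summable_mul_of_summable_norm hf.summable.norm hg.summable.norm)

/-- In the double series, put s = j + k + 1 and d = j - k. The exponent separates into an x-part in
s and a y-part in d, and the shifts of the arguments by 1/2 contribute (-1)^s. Since s and d have
opposite parity, the series splits in two: s even gives the first product, s odd the second with a
minus sign. -/
theorem theta1_mul_theta1 {τ : ℂ} (hτ : 0 < τ.im) (x y : ℂ) :
    theta1 τ (x + y) * theta1 τ (x - y)
      = evenTheta τ x * oddTheta τ y - oddTheta τ x * evenTheta τ y := by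
  have h2 : 0 < (2 * τ).im := by simpa using hτ
  have h := hasSum_mul_int (hasSum_theta1Term hτ (x + y)) (hasSum_theta1Term hτ (x - y))
  have hE : ∀ x, HasSum (fun n : ℤ => jacobiTheta₂_term n (2 * x) (2 * τ)) (evenTheta τ x) :=
    fun x => hasSum_jacobiTheta₂_term _ h2
  have hO : ∀ x, HasSum (fun n : ℤ => Complex.exp (Real.pi * Complex.I * (τ / 2 + 2 * x)) *
      jacobiTheta₂_term n (2 * x + τ) (2 * τ)) (oddTheta τ x) :=
    fun x => (hasSum_jacobiTheta₂_term _ h2).mul_left _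
  have hl := hasSum_mul_int (hE x) (hO y)
  have hr := (hasSum_mul_int (hO x) (hE y)).neg
  rw [neg_mul_neg] at h
  rw [← latticeSplit.hasSum_iff] at h
  have h' : HasSum ((fun p : ℤ × ℤ => theta1Term τ (x + y) p.1 * theta1Term τ (x - y) p.2) ∘
      latticeSplit) (evenTheta τ x * oddTheta τ y + -(oddTheta τ x * evenTheta τ y)) := by
    refine HasSum.sum ?_ ?_
    · convert! hl using 2 with p
      simp only [latticeSplit, Function.comp, Equiv.coe_fn_mk, theta1Term,
        jacobiTheta₂_term, ← Complex.exp_add]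
      push_cast
      rw [Complex.exp_eq_exp_iff_exists_int]
      refine ⟨p.1, ?_⟩
      ring
    · convert! hr using 2 with p
      simp only [latticeSplit, Function.comp, Equiv.coe_fn_mk, theta1Term,
        jacobiTheta₂_term, ← Complex.exp_add]
      push_cast
      rw [← mul_neg_one, ← Complex.exp_pi_mul_I, ← Complex.exp_add,
        Complex.exp_eq_exp_iff_exists_int]
      refine ⟨p.1, ?_⟩
      ring
  rw [h.unique h', sub_eq_add_neg]

/-- With [x,y] = E(x)O(y) - O(x)E(y), this is the Plücker relation [x,y][z,w] - [x,z][y,w] +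
[x,w][y,z] = 0. -/
theorem weierstrass_identity {τ : ℂ} (hτ : 0 < τ.im) (x y z w : ℂ) :
    (theta1 τ (x + y) * theta1 τ (x - y)) * (theta1 τ (z + w) * theta1 τ (z - w))
    - (theta1 τ (x + z) * theta1 τ (x - z)) * (theta1 τ (y + w) * theta1 τ (y - w))
    + (theta1 τ (x + w) * theta1 τ (x - w)) * (theta1 τ (y + z) * theta1 τ (y - z)) = 0 := by
  simp only [theta1_mul_theta1 hτ]
  ring

/-! ### Oddness, nonvanishing and zeros of θ₁ -/

/-- The integral extracts the constant Fourier coefficient. It serves to show that the theta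
function is not identically zero. -/
theorem jacobiTheta₂_integral {τ : ℂ} (hτ : 0 < τ.im) :
    ∫ x in (0 : ℝ)..1, jacobiTheta₂ (x : ℂ) τ = 1 := by
  have hnorm : ∀ (n : ℤ) (x : ℝ), ‖jacobiTheta₂_term n x τ‖ = ‖jacobiTheta₂_term n 0 τ‖ := by
    intro n x
    simp [norm_jacobiTheta₂_term]
  have h0 := ((summable_jacobiTheta₂_term_iff 0 τ).2 hτ).norm
  have h := intervalIntegral.hasSum_integral_of_dominated_convergence
    (μ := MeasureTheory.volume) (a := 0) (b := 1)
    (F := fun (n : ℤ) (x : ℝ) => jacobiTheta₂_term n x τ) (f := fun x : ℝ => jacobiTheta₂ x τ)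
    (fun n _ => ‖jacobiTheta₂_term n 0 τ‖)
    (fun n => by
      apply Continuous.aestronglyMeasurable
      unfold jacobiTheta₂_term
      fun_prop)
    (fun n => Filter.Eventually.of_forall fun x _ => (hnorm n x).le)
    (Filter.Eventually.of_forall fun x _ => h0)
    intervalIntegrable_const
    (Filter.Eventually.of_forall fun x _ => hasSum_jacobiTheta₂_term x hτ)
  refine h.unique ?_
  convert! hasSum_ite_eq (0 : ℤ) (1 : ℂ) using 2 with n
  split_ifs with hn
  · simp [hn, jacobiTheta₂_term]
  · have hc : 2 * (Real.pi : ℂ) * Complex.I * n ≠ 0 := by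
      simp [hn, Real.pi_ne_zero]
    have : ∀ x : ℝ, jacobiTheta₂_term n x τ =
        Complex.exp (2 * Real.pi * Complex.I * n * x) * Complex.exp (Real.pi * Complex.I * n ^ 2 * τ) := by
      intro x
      rw [jacobiTheta₂_term, Complex.exp_add]
    simp only [this, intervalIntegral.integral_mul_const]
    rw [integral_exp_mul_complex hc]
    have h1 : Complex.exp (2 * Real.pi * Complex.I * n) = 1 := by
      rw [Complex.exp_eq_one_iff]
      exact ⟨n, by ring⟩
    simp [h1]

theorem exists_theta1_ne_zero {τ : ℂ} (hτ : 0 < τ.im) : ∃ t, theta1 τ t ≠ 0 := by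
  by_contra! h
  have h0 : ∀ x, jacobiTheta₂ x τ = 0 := by
    intro x
    have := h (x - 1 / 2 - τ / 2)
    rw [theta1_eq_jacobiTheta₂, neg_eq_zero] at this
    have h2 := (mul_eq_zero.1 this).resolve_left (Complex.exp_ne_zero _)
    rwa [show x - 1 / 2 - τ / 2 + 1 / 2 + τ / 2 = x by ring] at h2
  have := jacobiTheta₂_integral hτ
  simp [h0] at this

/-- The determinant in `theta1_mul_theta1` is antisymmetric in x and y, so θ₁(s)θ₁(-t) =
-θ₁(s)θ₁(t); choose s with θ₁(s) ≠ 0. -/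
theorem theta1_neg {τ : ℂ} (hτ : 0 < τ.im) (t : ℂ) : theta1 τ (-t) = -theta1 τ t := by
  obtain ⟨s, hs⟩ := exists_theta1_ne_zero hτ
  have h1 := theta1_mul_theta1 hτ ((s + t) / 2) ((s - t) / 2)
  have h2 := theta1_mul_theta1 hτ ((s - t) / 2) ((s + t) / 2)
  rw [show (s + t) / 2 + (s - t) / 2 = s by ring, show (s + t) / 2 - (s - t) / 2 = t by ring] at h1
  rw [show (s - t) / 2 + (s + t) / 2 = s by ring, show (s - t) / 2 - (s + t) / 2 = -t by ring] at h2
  apply mul_left_cancel₀ hs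
  linear_combination h1 + h2

theorem theta1_zero {τ : ℂ} (hτ : 0 < τ.im) : theta1 τ 0 = 0 := by
  have := theta1_neg hτ 0
  rw [neg_zero] at this
  linear_combination this / 2

/-- Zeros are isolated by the identity theorem. The affine argument allows many theta values to be
made nonzero at once by moving a single parameter t. -/
theorem theta1_eventually_ne_zero {τ : ℂ} (hτ : 0 < τ.im) (c : ℂ) {k : ℂ} (hk : k ≠ 0) (t₀ : ℂ) :
    ∀ᶠ t in 𝓝[≠] t₀, theta1 τ (c + k * t) ≠ 0 := by
  have hd : Differentiable ℂ (fun t => theta1 τ (c + k * t)) :=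
    (differentiable_theta1 hτ).comp (by fun_prop)
  have ha : AnalyticOnNhd ℂ (fun t => theta1 τ (c + k * t)) Set.univ :=
    fun t _ => hd.analyticAt t
  refine (hd.analyticAt t₀).eventually_eq_zero_or_eventually_ne_zero.resolve_left fun h => ?_
  have h0 := ha.eq_of_eventuallyEq (g := fun _ => 0) (fun t _ => analyticAt_const) h
  obtain ⟨s, hs⟩ := exists_theta1_ne_zero hτ
  apply hs
  have := congrFun h0 ((s - c) / k)
  rwa [show c + k * ((s - c) / k) = s by field_simp; ring] at this

/-- The quotient f/g has zero derivative near q, hence is constant there; the identity theorem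
carries the proportionality past the zeros of g. -/
theorem eq_mul_of_wronskian_eq_zero {f g : ℂ → ℂ} (hf : Differentiable ℂ f)
    (hg : Differentiable ℂ g) (h : ∀ t, deriv f t * g t = f t * deriv g t) {q : ℂ} (hq : g q ≠ 0)
    (t : ℂ) : f t = f q / g q * g t := by
  have hev : ∀ᶠ t in 𝓝 q, g t ≠ 0 := hg.continuous.continuousAt.eventually_ne hq
  obtain ⟨r, hr, hb⟩ := Metric.eventually_nhds_iff_ball.1 hev
  have hconst : ∀ t ∈ Metric.ball q r, f t / g t = f q / g q := by
    intro t ht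
    refine Metric.isOpen_ball.is_const_of_deriv_eq_zero (f := fun t => f t / g t)
      (convex_ball q r).isPreconnected ?_ ?_ ht (Metric.mem_ball_self hr)
    · intro s hs
      exact ((hf s).div (hg s) (hb s hs)).differentiableWithinAt
    · intro s hs
      rw [deriv_fun_div (hf s) (hg s) (hb s hs), h s]
      simp
  have hE : f =ᶠ[𝓝 q] fun t => f q / g q * g t := by
    filter_upwards [Metric.ball_mem_nhds q hr] with t ht
    rw [← hconst t ht, div_mul_cancel₀ _ (hb t ht)]
  exact congrFun (AnalyticOnNhd.eq_of_eventuallyEq (𝕜 := ℂ) (fun t _ => hf.analyticAt t)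
    (fun t _ => (hg.const_mul _).analyticAt t) hE) t

/-- Let F_y(x) = θ₁(x+y)θ₁(x-y). Weierstrass's identity factors F_y(x)F_z(w) - F_z(x)F_y(w) with a
factor θ₁(x-w); differentiating in w at w = x shows that the Wronskian of F_y and F_z is a multiple
of θ₁'(0). If θ₁'(0) = 0, then F_q is proportional to F_0 = θ₁². At x = q the former vanishes and
the latter does not, so F_q is identically zero, which is impossible. -/
theorem deriv_theta1_zero_ne_zero {τ : ℂ} (hτ : 0 < τ.im) : deriv (theta1 τ) 0 ≠ 0 := by
  intro h0
  have hθ := differentiable_theta1 hτ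
  obtain ⟨q, hq⟩ := exists_theta1_ne_zero hτ
  let F : ℂ → ℂ → ℂ := fun y x => theta1 τ (x + y) * theta1 τ (x - y)
  have hF : ∀ y, Differentiable ℂ (F y) := fun y =>
    (hθ.comp (by fun_prop)).mul (hθ.comp (by fun_prop))
  have hW : ∀ y z x, deriv (F y) x * F z x = F y x * deriv (F z) x := by
    intro y z x
    have hw : ∀ w, F y x * F z w - F z x * F y w
        = theta1 τ (x + w) * theta1 τ (x - w) * (theta1 τ (y + z) * theta1 τ (y - z)) := by
      intro w
      have h1 := weierstrass_identity hτ x y z w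
      have h2 : theta1 τ (z - w) = -theta1 τ (w - z) := by
        rw [← theta1_neg hτ]; congr 1; ring
      have h3 : theta1 τ (y - w) = -theta1 τ (w - y) := by
        rw [← theta1_neg hτ]; congr 1; ring
      rw [h2, h3, add_comm z w, add_comm y w] at h1
      dsimp only [F]
      linear_combination -h1
    have hd1 : HasDerivAt (fun w => F y x * F z w - F z x * F y w)
        (F y x * deriv (F z) x - F z x * deriv (F y) x) x :=
      ((hF z x).hasDerivAt.const_mul _).sub ((hF y x).hasDerivAt.const_mul _)
    -- Here θ₁'(0) = 0 enters. The other term of the product rule contains θ₁(x - x) = 0.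
    have hsub : HasDerivAt (fun w => theta1 τ (x - w)) 0 x := by
      have h4 : HasDerivAt (theta1 τ) 0 (x - x) := by
        exact (hθ (x - x)).hasDerivAt.congr_deriv (by rw [sub_self, h0])
      simpa using h4.comp_const_sub x x
    have hadd : HasDerivAt (fun w => theta1 τ (x + w)) (deriv (theta1 τ) (x + x)) x := by
      exact (hθ (x + x)).hasDerivAt.comp_const_add x x
    have hd2 := (hadd.mul hsub).mul_const (theta1 τ (y + z) * theta1 τ (y - z))
    have hfun : (fun w => F y x * F z w - F z x * F y w) = fun w =>
        theta1 τ (x + w) * theta1 τ (x - w) * (theta1 τ (y + z) * theta1 τ (y - z)) := funext hw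
    rw [hfun] at hd1
    have := hd1.unique hd2
    rw [sub_self, theta1_zero hτ] at this
    linear_combination -this
  have hzero : ∀ x, F q x = 0 := by
    have hq0 : F 0 q ≠ 0 := by simp [F, hq]
    intro x
    rw [eq_mul_of_wronskian_eq_zero (hF q) (hF 0) (hW q 0) hq0 x]
    simp [F, theta1_zero hτ]
  have hne := (theta1_eventually_ne_zero hτ q one_ne_zero 0).and
    (theta1_eventually_ne_zero hτ (-q) one_ne_zero 0)
  obtain ⟨x, h1, h2⟩ := hne.exists
  have := hzero x
  rw [mul_eq_zero] at this
  rcases this with h | h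
  · exact h1 (by rw [← h]; congr 1; ring)
  · exact h2 (by rw [← h]; congr 1; ring)

/-- One of the three Weierstrass terms contains θ₁(a) and drops out. Formally, r(s) = θ₁(s-a)/θ₁(s)
satisfies r(p+e)r(q-e) = r(p)r(q), which forces r to be a constant times an exponential. -/
theorem theta1_exchange {τ a : ℂ} (hτ : 0 < τ.im) (ha : theta1 τ a = 0) (p q e : ℂ) :
    theta1 τ p * theta1 τ q * (theta1 τ (p + e - a) * theta1 τ (q - e - a))
      = theta1 τ (p + e) * theta1 τ (q - e) * (theta1 τ (p - a) * theta1 τ (q - a)) := by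
  have h := weierstrass_identity hτ ((p + q) / 2) ((p - q) / 2) ((p - q) / 2 + e) ((p + q) / 2 - a)
  rw [show (p + q) / 2 + (p - q) / 2 = p by ring, show (p + q) / 2 - (p - q) / 2 = q by ring,
    show (p - q) / 2 + e + ((p + q) / 2 - a) = p + e - a by ring,
    show (p - q) / 2 + e - ((p + q) / 2 - a) = -(q - e - a) by ring,
    show (p + q) / 2 + ((p - q) / 2 + e) = p + e by ring,
    show (p + q) / 2 - ((p - q) / 2 + e) = q - e by ring,
    show (p - q) / 2 + ((p + q) / 2 - a) = p - a by ring,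
    show (p - q) / 2 - ((p + q) / 2 - a) = -(q - a) by ring,
    show (p + q) / 2 - ((p + q) / 2 - a) = a by ring, ha, theta1_neg hτ, theta1_neg hτ] at h
  linear_combination -h

/-- By `theta1_exchange`, θ₁(p-a) = C exp(kp) θ₁(p). Comparing the behaviour of both sides under p ↦
p + 1 and p ↦ p + τ gives exp(k) = 1 and exp(kτ) = exp(2πia), so a lies in the lattice. -/
theorem theta1_eq_zero {τ a : ℂ} (hτ : 0 < τ.im) (ha : theta1 τ a = 0) :
    ∃ m n : ℤ, a = m + n * τ := by
  have hθ := differentiable_theta1 hτ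
  set f : ℂ → ℂ := fun s => theta1 τ (s - a) with hf_def
  have hf : Differentiable ℂ f := hθ.comp (by fun_prop)
  -- The e-derivative at e = 0 of the exchange relation: f'/f - θ₁'/θ₁ takes the same value at p and
  -- q, written without denominators.
  have hW : ∀ p q, theta1 τ p * theta1 τ q * (deriv f p * f q - f p * deriv f q)
      = (deriv (theta1 τ) p * theta1 τ q - theta1 τ p * deriv (theta1 τ) q) * (f p * f q) := by
    intro p q
    have hplus : ∀ {g : ℂ → ℂ}, Differentiable ℂ g →
        HasDerivAt (fun e => g (p + e)) (deriv g p) 0 := by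
      intro g hg
      have h4 : HasDerivAt g (deriv g p) (p + 0) := by rw [add_zero]; exact (hg p).hasDerivAt
      exact h4.comp_const_add p 0
    have hminus : ∀ {g : ℂ → ℂ}, Differentiable ℂ g →
        HasDerivAt (fun e => g (q - e)) (-deriv g q) 0 := by
      intro g hg
      have h4 : HasDerivAt g (deriv g q) (q - 0) := by rw [sub_zero]; exact (hg q).hasDerivAt
      exact h4.comp_const_sub q 0
    have hd1 := ((hplus hf).mul (hminus hf)).const_mul (theta1 τ p * theta1 τ q)
    have hd2 := ((hplus hθ).mul (hminus hθ)).mul_const (f p * f q)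
    have hfun : (fun e => theta1 τ p * theta1 τ q * (f (p + e) * f (q - e)))
        = fun e => theta1 τ (p + e) * theta1 τ (q - e) * (f p * f q) :=
      funext fun e => theta1_exchange hτ ha p q e
    have := HasDerivAt.unique (f := fun e => theta1 τ p * theta1 τ q * (f (p + e) * f (q - e)))
      hd1 (by rw [hfun]; exact hd2)
    simp only [add_zero, sub_zero] at this
    linear_combination this
  obtain ⟨q, hq1, hq2⟩ := ((theta1_eventually_ne_zero hτ 0 one_ne_zero 0).and
    (theta1_eventually_ne_zero hτ (-a) one_ne_zero 0)).exists
  replace hq1 : theta1 τ q ≠ 0 := by simpa using hq1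
  replace hq2 : f q ≠ 0 := by
    have : q - a = -a + 1 * q := by ring
    simpa only [hf_def, this] using hq2
  set k : ℂ := deriv f q / f q - deriv (theta1 τ) q / theta1 τ q with hk
  have hk1 : ∀ p, theta1 τ p * deriv f p - f p * deriv (theta1 τ) p = k * (theta1 τ p * f p) := by
    intro p
    have := hW p q
    rw [hk]
    field_simp
    linear_combination this
  -- Removing the exponential factor makes the Wronskian with θ₁ vanish.
  set g : ℂ → ℂ := fun p => Complex.exp (-(k * p)) * f p with hg_def
  have hg : Differentiable ℂ g := Differentiable.mul (by fun_prop) hf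
  have hgd : ∀ p, deriv g p = Complex.exp (-(k * p)) * (deriv f p - k * f p) := by
    intro p
    have h1 : HasDerivAt (fun p : ℂ => Complex.exp (-(k * p))) (Complex.exp (-(k * p)) * -(k * 1)) p :=
      ((hasDerivAt_id p).const_mul k).neg.cexp
    refine (h1.mul (hf p).hasDerivAt).deriv.trans ?_
    ring
  have hprop := eq_mul_of_wronskian_eq_zero hg hθ (fun p => by
    rw [hgd]
    linear_combination Complex.exp (-(k * p)) * hk1 p) hq1
  set C := g q / theta1 τ q
  have hfC : ∀ p, f p = C * Complex.exp (k * p) * theta1 τ p := by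
    intro p
    have h1 := hprop p
    have h2 : Complex.exp (k * p) * Complex.exp (-(k * p)) = 1 := by
      rw [← Complex.exp_add, add_neg_cancel, Complex.exp_zero]
    linear_combination Complex.exp (k * p) * h1 - f p * h2
  have h1 : Complex.exp k = 1 := by
    have e1 : f (q + 1) = -f q := by
      simp only [hf_def]
      rw [show q + 1 - a = q - a + 1 by ring, theta1_add_one]
    have e2 := hfC (q + 1)
    rw [theta1_add_one, e1, mul_add k, mul_one, Complex.exp_add] at e2
    apply mul_right_cancel₀ hq2
    linear_combination e2 + Complex.exp k * hfC q
  have h2 : Complex.exp (k * τ) = Complex.exp (2 * Real.pi * Complex.I * a) := by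
    have e1 : f (q + τ) = -(Complex.exp (-(Real.pi * Complex.I * (τ + 2 * q))) *
        Complex.exp (2 * Real.pi * Complex.I * a) * f q) := by
      simp only [hf_def]
      rw [show q + τ - a = q - a + τ by ring, theta1_add_tau, ← Complex.exp_add]
      congr 3
      ring
    have e2 := hfC (q + τ)
    rw [theta1_add_tau, e1, mul_add k, Complex.exp_add] at e2
    apply mul_right_cancel₀ hq2
    apply mul_left_cancel₀ (Complex.exp_ne_zero (-(Real.pi * Complex.I * (τ + 2 * q))))
    linear_combination e2 + Complex.exp (-(Real.pi * Complex.I * (τ + 2 * q))) *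
      Complex.exp (k * τ) * hfC q
  obtain ⟨n, hn⟩ := Complex.exp_eq_one_iff.1 h1
  obtain ⟨m, hm⟩ := Complex.exp_eq_exp_iff_exists_int.1 h2
  -- From k = 2πin and kτ = 2πia + 2πim.
  refine ⟨-m, n, ?_⟩
  have hpi : 2 * (Real.pi : ℂ) * Complex.I ≠ 0 := Complex.two_pi_I_ne_zero
  apply mul_left_cancel₀ hpi
  rw [hn] at hm
  push_cast
  linear_combination -hm

/-! ### The scalar identities -/

/-- The arguments are free variables, so that each use states the identity in the arguments it needs
and leaves linear equations to `ring`. -/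
theorem weierstrass_of_eq {τ : ℂ} (hτ : 0 < τ.im) (x y z w : ℂ)
    {a₁ a₂ a₃ a₄ b₁ b₂ b₃ b₄ c₁ c₂ c₃ c₄ : ℂ}
    (ha₁ : a₁ = x + y) (ha₂ : a₂ = x - y) (ha₃ : a₃ = z + w) (ha₄ : a₄ = z - w)
    (hb₁ : b₁ = x + z) (hb₂ : b₂ = x - z) (hb₃ : b₃ = y + w) (hb₄ : b₄ = y - w)
    (hc₁ : c₁ = x + w) (hc₂ : c₂ = x - w) (hc₃ : c₃ = y + z) (hc₄ : c₄ = y - z) :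
    (theta1 τ a₁ * theta1 τ a₂) * (theta1 τ a₃ * theta1 τ a₄)
    - (theta1 τ b₁ * theta1 τ b₂) * (theta1 τ b₃ * theta1 τ b₄)
    + (theta1 τ c₁ * theta1 τ c₂) * (theta1 τ c₃ * theta1 τ c₄) = 0 := by
  subst_vars
  exact weierstrass_identity hτ x y z w

/-- The diagonal coefficient of the elliptic R-matrix. -/
def diagCoef (τ γ z x : ℂ) : ℂ :=
  theta1 τ (γ - x) * theta1 τ z / (theta1 τ x * theta1 τ (γ - z))

/-- The exchange coefficient of the elliptic R-matrix. -/
def exchCoef (τ γ z x : ℂ) : ℂ :=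
  theta1 τ (x + z) * theta1 τ γ / (theta1 τ x * theta1 τ (γ - z))

/-- The diagonal coefficient is a function of z times a function of x, so spectral parameters can be
exchanged. -/
theorem diagCoef_mul_comm (τ γ z z' x x' : ℂ) :
    diagCoef τ γ z x * diagCoef τ γ z' x' = diagCoef τ γ z x' * diagCoef τ γ z' x := by
  unfold diagCoef
  ring

theorem unitarity_diag {τ : ℂ} (hτ : 0 < τ.im) (γ : ℂ) {z x : ℂ}
    (hx : theta1 τ x ≠ 0) (h1 : theta1 τ (γ - z) ≠ 0)
    (h2 : theta1 τ (γ + z) ≠ 0) :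
    diagCoef τ γ (-z) (-x) * diagCoef τ γ z x + exchCoef τ γ (-z) (-x) * exchCoef τ γ z (-x) = 1 := by
  have h : theta1 τ (γ + x) * theta1 τ (γ - x) * (theta1 τ z * theta1 τ z)
      - theta1 τ (γ + z) * theta1 τ (γ - z) * (theta1 τ x * theta1 τ x)
      + theta1 τ γ * theta1 τ γ * (theta1 τ (x + z) * theta1 τ (x - z)) = 0 := by
    refine weierstrass_of_eq hτ γ x z 0 ?_ ?_ ?_ ?_ ?_ ?_ ?_ ?_ ?_ ?_ ?_ ?_ <;> ring
  unfold diagCoef exchCoef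
  rw [show γ - -x = γ + x by ring, show γ - -z = γ + z by ring, show -x + -z = -(x + z) by ring,
    show -x + z = -(x - z) by ring]
  simp only [theta1_neg hτ]
  field_simp
  linear_combination h

theorem unitarity_exch {τ : ℂ} (hτ : 0 < τ.im) (γ z x : ℂ) :
    diagCoef τ γ (-z) (-x) * exchCoef τ γ z x + exchCoef τ γ (-z) (-x) * diagCoef τ γ z (-x) = 0 := by
  unfold diagCoef exchCoef
  rw [show γ - -x = γ + x by ring, show γ - -z = γ + z by ring, show -x + -z = -(x + z) by ring]
  simp only [theta1_neg hτ]
  ring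

/-- For distinct indices, the coefficient of a cyclic permutation of e_a ⊗ e_b ⊗ e_c. -/
theorem exch_three_term {τ : ℂ} (hτ : 0 < τ.im) (γ : ℂ) {u v x y : ℂ}
    (hx : theta1 τ x ≠ 0) (hy : theta1 τ y ≠ 0)
    (hxy : theta1 τ (x + y) ≠ 0)
    (hu : theta1 τ (γ - u) ≠ 0) (hv : theta1 τ (γ - v) ≠ 0) (hw : theta1 τ (γ - (u + v)) ≠ 0) :
    exchCoef τ γ v y * diagCoef τ γ (u + v) x * exchCoef τ γ u (x + y) =
      diagCoef τ γ u x * exchCoef τ γ (u + v) (x + y) * exchCoef τ γ v (-x)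
      + exchCoef τ γ u x * exchCoef τ γ (u + v) y * diagCoef τ γ v x := by
  have h : theta1 τ (x + y + u) * theta1 τ x * (theta1 τ (y + v) * theta1 τ (u + v))
      - theta1 τ (x + y + (u + v)) * theta1 τ (x - v) * (theta1 τ y * theta1 τ u)
      + theta1 τ (x + y) * theta1 τ (x + u) * (theta1 τ (y + (u + v)) * theta1 τ (-v)) = 0 := by
    refine weierstrass_of_eq hτ (x + (y + u) / 2) ((y + u) / 2) ((y + u) / 2 + v) ((y - u) / 2)
      ?_ ?_ ?_ ?_ ?_ ?_ ?_ ?_ ?_ ?_ ?_ ?_ <;> ring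
  unfold diagCoef exchCoef
  rw [show -x + v = -(x - v) by ring]
  simp only [theta1_neg hτ] at h ⊢
  field_simp
  linear_combination theta1 τ γ ^ 2 * theta1 τ (γ - x) * h

/-- The coefficient of the reversal e_c ⊗ e_b ⊗ e_a. Two Weierstrass identities are needed: `h'`
turns the difference of the two terms with diagonal factors into a multiple of θ₁(γ)³, and `h`
cancels it against the pure exchange terms. -/
theorem exch_four_term {τ : ℂ} (hτ : 0 < τ.im) (γ : ℂ) {u v x y : ℂ}
    (hx : theta1 τ x ≠ 0) (hy : theta1 τ y ≠ 0)
    (hxy : theta1 τ (x + y) ≠ 0)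
    (hu : theta1 τ (γ - u) ≠ 0) (hv : theta1 τ (γ - v) ≠ 0) (hw : theta1 τ (γ - (u + v)) ≠ 0) :
    diagCoef τ γ v y * exchCoef τ γ (u + v) (x + y) * diagCoef τ γ u (-y)
      + exchCoef τ γ v y * exchCoef τ γ (u + v) x * exchCoef τ γ u y =
    diagCoef τ γ u x * exchCoef τ γ (u + v) (x + y) * diagCoef τ γ v (-x)
      + exchCoef τ γ u x * exchCoef τ γ (u + v) y * exchCoef τ γ v x := by
  have h : theta1 τ (x + y + (u + v)) * theta1 τ (y - x) * (theta1 τ u * theta1 τ v)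
      - theta1 τ (y + (u + v)) * theta1 τ y * (theta1 τ (x + u) * theta1 τ (x + v))
      + theta1 τ (y + u) * theta1 τ (y + v) * (theta1 τ (x + (u + v)) * theta1 τ x) = 0 := by
    refine weierstrass_of_eq hτ (y + (u + v) / 2) (x + (u + v) / 2) ((u + v) / 2) ((u - v) / 2)
      ?_ ?_ ?_ ?_ ?_ ?_ ?_ ?_ ?_ ?_ ?_ ?_ <;> ring
  have h' : theta1 τ (γ + x) * theta1 τ (γ - x) * (theta1 τ y * theta1 τ y)
      - theta1 τ (γ + y) * theta1 τ (γ - y) * (theta1 τ x * theta1 τ x)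
      + theta1 τ γ * theta1 τ γ * (theta1 τ (x + y) * theta1 τ (-(y - x))) = 0 := by
    refine weierstrass_of_eq hτ γ x y 0 ?_ ?_ ?_ ?_ ?_ ?_ ?_ ?_ ?_ ?_ ?_ ?_ <;> ring
  unfold diagCoef exchCoef
  rw [show γ - -x = γ + x by ring, show γ - -y = γ + y by ring]
  simp only [theta1_neg hτ] at h h' ⊢
  field_simp
  linear_combination theta1 τ γ ^ 3 * theta1 τ (x + y) * h +
    theta1 τ γ * theta1 τ u * theta1 τ v * theta1 τ (x + y + (u + v)) * h'

/-- The first of the identities for a repeated index: the arguments x and x - γ come from shifting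
the same difference of coordinates by γ/2 and -γ/2. -/
theorem double_exch {τ : ℂ} (hτ : 0 < τ.im) (γ : ℂ) {u v x : ℂ}
    (hx : theta1 τ x ≠ 0) (hx' : theta1 τ (x - γ) ≠ 0)
    (hu : theta1 τ (γ - u) ≠ 0) (hv : theta1 τ (γ - v) ≠ 0) (hw : theta1 τ (γ - (u + v)) ≠ 0) :
    diagCoef τ γ v x * exchCoef τ γ (u + v) (x - γ) * diagCoef τ γ u (-x)
      + exchCoef τ γ v x * exchCoef τ γ u x = exchCoef τ γ (u + v) x := by
  have h : theta1 τ (x + (u + v)) * theta1 τ x * (theta1 τ (γ - u) * theta1 τ (γ - v))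
      - theta1 τ (γ + x) * theta1 τ (x - γ + (u + v)) * (theta1 τ v * theta1 τ u)
      + theta1 τ (x + v) * theta1 τ (x + u) * (theta1 τ γ * theta1 τ (-(γ - (u + v)))) = 0 := by
    refine weierstrass_of_eq hτ (x + (u + v) / 2) ((u + v) / 2) (γ - (u + v) / 2) ((v - u) / 2)
      ?_ ?_ ?_ ?_ ?_ ?_ ?_ ?_ ?_ ?_ ?_ ?_ <;> ring
  unfold diagCoef exchCoef
  rw [show γ - -x = γ + x by ring, show γ - x = -(x - γ) by ring]
  simp only [theta1_neg hτ] at h ⊢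
  field_simp
  linear_combination -theta1 τ γ * h

/-- The common numerator of `mixed_exch_left` (with u and v swapped) and `mixed_exch_right`. -/
theorem theta1_mixed {τ : ℂ} (hτ : 0 < τ.im) (γ u v x : ℂ) :
    theta1 τ v * theta1 τ (x + u) * theta1 τ (γ - (u + v)) * theta1 τ (x - γ)
      + theta1 τ (x - v) * theta1 τ (x - γ + (u + v)) * theta1 τ γ * theta1 τ u
      = theta1 τ (x - γ + u) * theta1 τ (u + v) * theta1 τ (γ - v) * theta1 τ x := by
  have h : theta1 τ x * theta1 τ (γ - v) * (theta1 τ (x - γ + u) * theta1 τ (u + v))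
      - theta1 τ (x + u) * theta1 τ (γ - (u + v)) * (theta1 τ (x - γ) * theta1 τ v)
      + theta1 τ (x - v) * theta1 τ γ * (theta1 τ (x - γ + (u + v)) * theta1 τ (-u)) = 0 := by
    refine weierstrass_of_eq hτ ((x + γ - v) / 2) ((x - γ + v) / 2) ((x - γ + v) / 2 + u)
      ((x - γ - v) / 2) ?_ ?_ ?_ ?_ ?_ ?_ ?_ ?_ ?_ ?_ ?_ ?_ <;> ring
  simp only [theta1_neg hτ] at h
  linear_combination -h

theorem mixed_exch_left {τ : ℂ} (hτ : 0 < τ.im) (γ : ℂ) {u v x : ℂ}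
    (hx : theta1 τ x ≠ 0) (hx' : theta1 τ (x - γ) ≠ 0)
    (hu : theta1 τ (γ - u) ≠ 0) (hv : theta1 τ (γ - v) ≠ 0) (hw : theta1 τ (γ - (u + v)) ≠ 0) :
    diagCoef τ γ v x * exchCoef τ γ (u + v) (x - γ) * exchCoef τ γ u (-x)
      + exchCoef τ γ v x * diagCoef τ γ u x
      = diagCoef τ γ (u + v) x * exchCoef τ γ v (x - γ) := by
  have h := theta1_mixed hτ γ v u x
  rw [add_comm v u] at h
  unfold diagCoef exchCoef
  rw [show -x + u = -(x - u) by ring]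
  simp only [theta1_neg hτ] at h ⊢
  field_simp
  linear_combination theta1 τ γ * theta1 τ (γ - x) * h

theorem mixed_exch_right {τ : ℂ} (hτ : 0 < τ.im) (γ : ℂ) {u v x : ℂ}
    (hx : theta1 τ x ≠ 0) (hx' : theta1 τ (x - γ) ≠ 0)
    (hu : theta1 τ (γ - u) ≠ 0) (hv : theta1 τ (γ - v) ≠ 0) (hw : theta1 τ (γ - (u + v)) ≠ 0) :
    diagCoef τ γ v (-x) * exchCoef τ γ u x
      + exchCoef τ γ v (-x) * exchCoef τ γ (u + v) (x - γ) * diagCoef τ γ u (-x)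
      = exchCoef τ γ u (x - γ) * diagCoef τ γ (u + v) (-x) := by
  have h := theta1_mixed hτ γ u v x
  unfold diagCoef exchCoef
  rw [show -x + v = -(x - v) by ring]
  simp only [theta1_neg hτ] at h ⊢
  field_simp
  linear_combination -theta1 τ γ * theta1 τ (γ - -x) * h

/-- The coefficient of e_p ⊗ e_q ⊗ e_p in its own image. As in `exch_four_term`, `h'` handles the
products of diagonal coefficients and `h` the triple exchanges. -/
theorem exch_middle {τ : ℂ} (hτ : 0 < τ.im) (γ : ℂ) {u v x : ℂ}
    (hx : theta1 τ x ≠ 0) (hx' : theta1 τ (x - γ) ≠ 0)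
    (hu : theta1 τ (γ - u) ≠ 0) (hv : theta1 τ (γ - v) ≠ 0) (hw : theta1 τ (γ - (u + v)) ≠ 0) :
    diagCoef τ γ v (-x) * diagCoef τ γ u x
      + exchCoef τ γ v (-x) * exchCoef τ γ (u + v) (x - γ) * exchCoef τ γ u (-x)
      = diagCoef τ γ u (x - γ) * diagCoef τ γ v (-(x - γ))
      + exchCoef τ γ u (x - γ) * exchCoef τ γ (u + v) (-x) * exchCoef τ γ v (x - γ) := by
  have h : theta1 τ (x + (x - γ)) * theta1 τ (γ - (u + v)) * (theta1 τ u * theta1 τ v)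
      - theta1 τ x * theta1 τ (x - (u + v)) * (theta1 τ (x - γ + u) * theta1 τ (x - γ + v))
      + theta1 τ (x - v) * theta1 τ (x - u) * (theta1 τ (x - γ + (u + v)) * theta1 τ (x - γ)) = 0 := by
    refine weierstrass_of_eq hτ (x - (u + v) / 2) (x - γ + (u + v) / 2) ((u + v) / 2) ((u - v) / 2)
      ?_ ?_ ?_ ?_ ?_ ?_ ?_ ?_ ?_ ?_ ?_ ?_ <;> ring
  have h' : theta1 τ x * theta1 τ (γ - (x - γ)) * (theta1 τ x * theta1 τ x)
      - theta1 τ (γ + x) * theta1 τ (-(x - γ)) * (theta1 τ (x - γ) * theta1 τ (x - γ))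
      + theta1 τ γ * theta1 τ γ * (theta1 τ (x + (x - γ)) * theta1 τ (-γ)) = 0 := by
    refine weierstrass_of_eq hτ γ (x - γ) x 0 ?_ ?_ ?_ ?_ ?_ ?_ ?_ ?_ ?_ ?_ ?_ ?_ <;> ring
  unfold diagCoef exchCoef
  rw [show γ - -x = γ + x by ring, show γ - -(x - γ) = x by ring, show -x + v = -(x - v) by ring,
    show -x + u = -(x - u) by ring, show -x + (u + v) = -(x - (u + v)) by ring,
    show γ - x = -(x - γ) by ring]
  simp only [theta1_neg hτ] at h h' ⊢
  field_simp
  linear_combination theta1 τ γ ^ 3 * h + theta1 τ u * theta1 τ v * theta1 τ (γ - (u + v)) * h'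

/-! ### Weights of the vector representation -/

theorem diagAction_apply_apply (N : ℕ) (x v : Fin N → ℂ) (i : Fin N) :
    diagAction N x v i = x i * v i := by
  rw [diagAction_apply, Matrix.toLin'_apply, Matrix.mulVec_diagonal]

theorem diagTraceForm_eq_sum (N : ℕ) (a b : Fin N → ℂ) :
    diagTraceForm N a b = ∑ i, a i * b i := by
  rw [diagTraceForm_apply, Matrix.diagonal_mul_diagonal, Matrix.trace_diagonal]

theorem matE_single (N : ℕ) (i j k : Fin N) :
    matE N i j (Pi.single k 1) = if j = k then Pi.single i 1 else 0 := by
  rw [matE, Matrix.toLin'_apply]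
  ext m
  simp only [Matrix.mulVec_single_one, Matrix.col_apply, Matrix.single_apply]
  split_ifs with h1 h2 h2 <;> simp_all [eq_comm]

theorem mem_weightSpace_iff {N : ℕ} {μ v : Fin N → ℂ} :
    v ∈ weightSpace (diagTraceForm N) (diagAction N) μ ↔
      ∀ j, μ ≠ Pi.single j 1 → v j = 0 := by
  simp only [weightSpace, Submodule.mem_iInf, LinearMap.mem_ker, LinearMap.sub_apply,
    LinearMap.smul_apply, Module.End.one_apply, sub_eq_zero, funext_iff, diagAction_apply_apply,
    Pi.smul_apply, smul_eq_mul]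
  constructor
  · intro h j hj
    by_contra hv
    apply hj
    funext k
    -- Testing the weight condition on E_kk reads off the k-th coordinate of μ.
    have := mul_right_cancel₀ hv (h (Pi.single k 1) j)
    rw [diagTraceForm_eq_sum] at this
    simp only [Pi.single_apply, mul_ite, mul_one, mul_zero, Finset.sum_ite_eq', Finset.mem_univ,
      if_true] at this
    rw [← this, Pi.single_apply]
    simp only [eq_comm]
  · intro h x j
    by_cases hj : μ = Pi.single j 1
    · subst hj
      rw [diagTraceForm_eq_sum]
      simp [Pi.single_apply]
    · simp [h j hj]

theorem mem_iSup_weightSpace_iff {N : ℕ} {μ v : Fin N → ℂ} :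
    v ∈ ⨆ (ν : Fin N → ℂ) (_ : ν ≠ μ), weightSpace (diagTraceForm N) (diagAction N) ν ↔
      ∀ j, μ = Pi.single j 1 → v j = 0 := by
  constructor
  · intro hv j hj
    have hle : (⨆ (ν : Fin N → ℂ) (_ : ν ≠ μ), weightSpace (diagTraceForm N) (diagAction N) ν) ≤
        LinearMap.ker (LinearMap.proj (R := ℂ) (φ := fun _ : Fin N => ℂ) j) := by
      refine iSup₂_le fun ν hν w hw => ?_
      exact mem_weightSpace_iff.1 hw j (by rw [← hj]; exact hν)
    exact hle hv
  · intro h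
    rw [pi_eq_sum_univ' v]
    refine Submodule.sum_mem _ fun j _ => ?_
    by_cases hj : μ = Pi.single j 1
    · rw [h j hj, zero_smul]
      exact Submodule.zero_mem _
    · refine Submodule.smul_mem _ _ (Submodule.mem_iSup_of_mem (Pi.single j 1)
        (Submodule.mem_iSup_of_mem (Ne.symm hj) (mem_weightSpace_iff.2 fun k hk => ?_)))
      have : k ≠ j := by rintro rfl; exact hk rfl
      simp [this]

theorem iSup_weightSpace (N : ℕ) :
    ⨆ μ : Fin N → ℂ, weightSpace (diagTraceForm N) (diagAction N) μ = ⊤ := by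
  rw [eq_top_iff]
  intro v _
  rw [pi_eq_sum_univ' v]
  refine Submodule.sum_mem _ fun j _ => Submodule.smul_mem _ _
    (Submodule.mem_iSup_of_mem (Pi.single j 1) (mem_weightSpace_iff.2 fun k hk => ?_))
  have : k ≠ j := by rintro rfl; exact hk rfl
  simp [this]

theorem weightSpace_single_ne_bot (N : ℕ) (i : Fin N) :
    weightSpace (diagTraceForm N) (diagAction N) (Pi.single i 1) ≠ ⊥ := by
  intro h
  have : (Pi.single i 1 : Fin N → ℂ) ∈ weightSpace (diagTraceForm N) (diagAction N)
      (Pi.single i 1) := mem_weightSpace_iff.2 fun k hk => by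
    have : k ≠ i := by rintro rfl; exact hk rfl
    simp [this]
  rw [h, Submodule.mem_bot] at this
  simpa using congrFun this i

theorem isCompl_weightSpace (N : ℕ) (μ : Fin N → ℂ) :
    IsCompl (weightSpace (diagTraceForm N) (diagAction N) μ)
      (⨆ (ν : Fin N → ℂ) (_ : ν ≠ μ), weightSpace (diagTraceForm N) (diagAction N) ν) := by
  classical
  constructor
  · rw [Submodule.disjoint_def]
    intro v h1 h2
    funext j
    by_cases hj : μ = Pi.single j 1
    · exact mem_iSup_weightSpace_iff.1 h2 j hj
    · exact mem_weightSpace_iff.1 h1 j hj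
  · rw [codisjoint_iff, eq_top_iff]
    intro v _
    rw [Submodule.mem_sup]
    refine ⟨fun j => if μ = Pi.single j 1 then v j else 0,
      mem_weightSpace_iff.2 fun j hj => if_neg hj,
      fun j => if μ = Pi.single j 1 then 0 else v j,
      mem_iSup_weightSpace_iff.2 fun j hj => if_pos hj, ?_⟩
    funext j
    simp only [Pi.add_apply]
    split_ifs <;> simp

open Classical in
theorem weightProj_apply (N : ℕ) (μ v : Fin N → ℂ) :
    weightProj (diagTraceForm N) (diagAction N) μ v =
      fun j => if μ = Pi.single j 1 then v j else 0 := by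
  rw [weightProj, dif_pos (isCompl_weightSpace N μ)]
  set w : Fin N → ℂ := fun j => if μ = Pi.single j 1 then v j else 0 with hw
  have h1 : w ∈ weightSpace (diagTraceForm N) (diagAction N) μ :=
    mem_weightSpace_iff.2 fun j hj => if_neg hj
  have h2 : v - w ∈ ⨆ (ν : Fin N → ℂ) (_ : ν ≠ μ),
      weightSpace (diagTraceForm N) (diagAction N) ν :=
    mem_iSup_weightSpace_iff.2 fun j hj => by simp [hw, hj]
  conv_lhs => rw [show v = w + (v - w) by abel]
  rw [map_add, Submodule.projection_apply_of_mem_left _ h1, Submodule.projection_apply_of_mem_right _ h2, add_zero]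

theorem single_one_injective (N : ℕ) :
    Function.Injective fun i : Fin N => (Pi.single i 1 : Fin N → ℂ) := by
  intro i j h
  by_contra hij
  have := congrFun h i
  simp [hij] at this

theorem weightProj_single (N : ℕ) (i : Fin N) :
    weightProj (diagTraceForm N) (diagAction N) (Pi.single i 1) = matE N i i := by
  refine (Pi.basisFun ℂ (Fin N)).ext fun k => ?_
  rw [Pi.basisFun_apply, matE_single, weightProj_apply]
  have hinj : ∀ j : Fin N, (Pi.single i 1 : Fin N → ℂ) = Pi.single j 1 ↔ i = j :=
    fun j => (single_one_injective N).eq_iff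
  funext j
  simp only [hinj]
  split_ifs with h1 h2 h2
  · rw [h2]
  · rw [← h1, Pi.single_eq_of_ne h2, Pi.zero_apply]
  · rw [Pi.single_eq_of_ne (Ne.symm h1)]
  · rfl

theorem weightProj_eq_zero {N : ℕ} {μ : Fin N → ℂ} (h : ∀ i, μ ≠ Pi.single i 1) :
    weightProj (diagTraceForm N) (diagAction N) μ = 0 := by
  refine LinearMap.ext fun v => ?_
  rw [weightProj_apply]
  funext j
  exact if_neg (h j)

/-- The weights of ℂ^N are the coordinate vectors; every other projection is 0, and `hop` removes
its term. -/
theorem dynShift_eq_sum {N : ℕ}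
    {op : Module.End ℂ (Fin N → ℂ) →
      Module.End ℂ ((Fin N → ℂ) ⊗[ℂ] ((Fin N → ℂ) ⊗[ℂ] (Fin N → ℂ)))}
    (hop : op 0 = 0) (η : ℂ)
    (f : (Fin N → ℂ) → Module.End ℂ ((Fin N → ℂ) ⊗[ℂ] ((Fin N → ℂ) ⊗[ℂ] (Fin N → ℂ))))
    (l : Fin N → ℂ) :
    dynShift (diagTraceForm N) (diagAction N) op η f l =
      ∑ i, op (matE N i i) * f (l + η • Pi.single i 1) := by
  classical
  rw [dynShift, finsum_eq_sum_of_support_subset (s := Finset.univ.image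
    fun i : Fin N => (Pi.single i 1 : Fin N → ℂ)), Finset.sum_image (single_one_injective N).injOn]
  · simp only [weightProj_single]
  · intro μ hμ
    by_contra hne
    apply hμ
    dsimp only
    rw [weightProj_eq_zero, hop, zero_mul]
    intro i hi
    apply hne
    simp [hi]

/-! ### The action on tensor products of basis vectors -/

/-- The coefficient of `e_i ⊗ e_j` in `R(z, l) (e_i ⊗ e_j)`. -/
def coefD {N : ℕ} (τ γ z : ℂ) (l : Fin N → ℂ) (i j : Fin N) : ℂ :=
  if i = j then 1 else sigma τ γ (l i - l j) / sigma τ γ z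

/-- The coefficient of `e_j ⊗ e_i` in `R(z, l) (e_i ⊗ e_j)` for `i ≠ j`, and zero for `i = j`. -/
def coefS {N : ℕ} (τ γ z : ℂ) (l : Fin N → ℂ) (i j : Fin N) : ℂ :=
  if i = j then 0 else sigma τ (l j - l i) z / sigma τ γ z

/-- The basis vector `e_i ⊗ e_j`. -/
def basis2 {N : ℕ} (i j : Fin N) : (Fin N → ℂ) ⊗[ℂ] (Fin N → ℂ) :=
  Pi.single i 1 ⊗ₜ Pi.single j 1

/-- The basis vector `e_i ⊗ e_j ⊗ e_k`. -/
def basis3 {N : ℕ} (i j k : Fin N) : (Fin N → ℂ) ⊗[ℂ] ((Fin N → ℂ) ⊗[ℂ] (Fin N → ℂ)) :=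
  Pi.single i 1 ⊗ₜ basis2 j k

theorem end_ext2 {N : ℕ} {A B : Module.End ℂ ((Fin N → ℂ) ⊗[ℂ] (Fin N → ℂ))}
    (h : ∀ i j, A (basis2 i j) = B (basis2 i j)) : A = B := by
  refine ((Pi.basisFun ℂ (Fin N)).tensorProduct (Pi.basisFun ℂ (Fin N))).ext ?_
  rintro ⟨i, j⟩
  simpa [basis2] using h i j

theorem end_ext3 {N : ℕ}
    {A B : Module.End ℂ ((Fin N → ℂ) ⊗[ℂ] ((Fin N → ℂ) ⊗[ℂ] (Fin N → ℂ)))}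
    (h : ∀ i j k, A (basis3 i j k) = B (basis3 i j k)) : A = B := by
  refine ((Pi.basisFun ℂ (Fin N)).tensorProduct
    ((Pi.basisFun ℂ (Fin N)).tensorProduct (Pi.basisFun ℂ (Fin N)))).ext ?_
  rintro ⟨i, j, k⟩
  simpa [basis3, basis2] using h i j k

theorem sum_sum_filter_ne {N : ℕ} {M : Type*} [AddCommMonoid M] (g : Fin N → Fin N → M)
    (i j : Fin N) (hg : ∀ a b, ¬(a = i ∧ b = j) → g a b = 0) :
    ∑ a, ∑ b ∈ Finset.univ.filter (fun b => a ≠ b), g a b = if i = j then 0 else g i j := by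
  rw [Finset.sum_eq_single i]
  · rw [Finset.sum_filter, Finset.sum_eq_single j]
    · by_cases h : i = j <;> simp [h]
    · intro b _ hb
      rw [hg i b (fun h => hb h.2), ite_self]
    · simp
  · intro a _ ha
    exact Finset.sum_eq_zero fun b _ => hg a b fun h => ha h.1
  · simp

theorem ellipticR_basis2 {N : ℕ} (τ γ z : ℂ) (l : Fin N → ℂ) (i j : Fin N) :
    ellipticR N τ γ z l (basis2 i j) =
      coefD τ γ z l i j • basis2 i j + coefS τ γ z l i j • basis2 j i := by
  simp only [ellipticR, basis2, LinearMap.add_apply, LinearMap.sum_apply, LinearMap.smul_apply,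
    TensorProduct.map_tmul, matE_single]
  -- The exchange term acting on e_i ⊗ e_j is E_ji ⊗ E_ij, hence the reversed pair in the second
  -- sum.
  rw [sum_sum_filter_ne _ i j, sum_sum_filter_ne _ j i, Finset.sum_eq_single i]
  · by_cases h : i = j
    · subst h
      simp [coefD, coefS]
    · simp [coefD, coefS, h, Ne.symm h]
  · intro b _ hb
    simp [hb]
  · simp
  · intro a b hab
    by_cases ha : a = j
    · have hb : b ≠ i := fun h => hab ⟨ha, h⟩
      simp [hb]
    · simp [ha]
  · intro a b hab
    by_cases ha : a = i
    · have hb : b ≠ j := fun h => hab ⟨ha, h⟩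
      simp [hb]
    · simp [ha]

theorem leg21_ellipticR_basis2 {N : ℕ} (τ γ z : ℂ) (l : Fin N → ℂ) (i j : Fin N) :
    leg21 (ellipticR N τ γ z l) (basis2 i j) =
      coefD τ γ z l j i • basis2 i j + coefS τ γ z l j i • basis2 j i := by
  have h := ellipticR_basis2 τ γ z l j i
  simp only [basis2] at h ⊢
  simp [leg21, LinearEquiv.conj_apply, h]

theorem leg12_ellipticR_basis3 {N : ℕ} (τ γ z : ℂ) (l : Fin N → ℂ) (a b c : Fin N) :
    leg12 (ellipticR N τ γ z l) (basis3 a b c) =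
      coefD τ γ z l a b • basis3 a b c + coefS τ γ z l a b • basis3 b a c := by
  have h := ellipticR_basis2 τ γ z l a b
  simp only [basis3, basis2] at h ⊢
  simp [leg12, LinearEquiv.conj_apply, h, TensorProduct.add_tmul, TensorProduct.smul_tmul']

theorem leg23_ellipticR_basis3 {N : ℕ} (τ γ z : ℂ) (l : Fin N → ℂ) (a b c : Fin N) :
    leg23 (ellipticR N τ γ z l) (basis3 a b c) =
      coefD τ γ z l b c • basis3 a b c + coefS τ γ z l b c • basis3 a c b := by
  simp [leg23, basis3, ellipticR_basis2, TensorProduct.tmul_add]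

theorem leg13_ellipticR_basis3 {N : ℕ} (τ γ z : ℂ) (l : Fin N → ℂ) (a b c : Fin N) :
    leg13 (ellipticR N τ γ z l) (basis3 a b c) =
      coefD τ γ z l a c • basis3 a b c + coefS τ γ z l a c • basis3 c b a := by
  have h := leg12_ellipticR_basis3 τ γ z l a c b
  simp only [basis3, basis2] at h ⊢
  rw [leg13, LinearEquiv.conj_apply]
  simp [h]

theorem op1_matE_basis3 {N : ℕ} (k a b c : Fin N) :
    op1 (matE N k k) (basis3 a b c) = if k = a then basis3 a b c else 0 := by
  simp only [op1, basis3, LinearMap.rTensor_tmul, matE_single]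
  split_ifs with h
  · rw [h]
  · rw [TensorProduct.zero_tmul]

theorem op2_matE_basis3 {N : ℕ} (k a b c : Fin N) :
    op2 (matE N k k) (basis3 a b c) = if k = b then basis3 a b c else 0 := by
  simp only [op2, basis3, basis2, LinearMap.rTensor_tmul, LinearMap.lTensor_tmul, matE_single]
  split_ifs with h
  · rw [h]
  · rw [TensorProduct.zero_tmul, TensorProduct.tmul_zero]

theorem op3_matE_basis3 {N : ℕ} (k a b c : Fin N) :
    op3 (matE N k k) (basis3 a b c) = if k = c then basis3 a b c else 0 := by
  simp only [op3, basis3, basis2, LinearMap.lTensor_tmul, matE_single]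
  split_ifs with h
  · rw [h]
  · rw [TensorProduct.tmul_zero, TensorProduct.tmul_zero]

theorem dynShift_leg12_basis3 {N : ℕ} (τ γ z η : ℂ) (l : Fin N → ℂ) (a b c : Fin N) :
    dynShift (diagTraceForm N) (diagAction N) op3 η (fun m => leg12 (ellipticR N τ γ z m)) l
        (basis3 a b c) =
      coefD τ γ z (l + η • Pi.single c 1) a b • basis3 a b c
        + coefS τ γ z (l + η • Pi.single c 1) a b • basis3 b a c := by
  rw [dynShift_eq_sum (by simp [op3])]
  simp [LinearMap.sum_apply, leg12_ellipticR_basis3, op3_matE_basis3, Finset.sum_add_distrib]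

theorem dynShift_leg13_basis3 {N : ℕ} (τ γ z η : ℂ) (l : Fin N → ℂ) (a b c : Fin N) :
    dynShift (diagTraceForm N) (diagAction N) op2 η (fun m => leg13 (ellipticR N τ γ z m)) l
        (basis3 a b c) =
      coefD τ γ z (l + η • Pi.single b 1) a c • basis3 a b c
        + coefS τ γ z (l + η • Pi.single b 1) a c • basis3 c b a := by
  rw [dynShift_eq_sum (by simp [op2])]
  simp [LinearMap.sum_apply, leg13_ellipticR_basis3, op2_matE_basis3, Finset.sum_add_distrib]

theorem dynShift_leg23_basis3 {N : ℕ} (τ γ z η : ℂ) (l : Fin N → ℂ) (a b c : Fin N) :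
    dynShift (diagTraceForm N) (diagAction N) op1 η (fun m => leg23 (ellipticR N τ γ z m)) l
        (basis3 a b c) =
      coefD τ γ z (l + η • Pi.single a 1) b c • basis3 a b c
        + coefS τ γ z (l + η • Pi.single a 1) b c • basis3 a c b := by
  rw [dynShift_eq_sum (by simp [op1])]
  simp [LinearMap.sum_apply, leg23_ellipticR_basis3, op1_matE_basis3, Finset.sum_add_distrib]

/-- R mixes only e_i ⊗ e_j and e_j ⊗ e_i, and X acts on both by X_i + X_j. -/
theorem commute_weight_ellipticR {N : ℕ} (τ γ z : ℂ) (l X : Fin N → ℂ) :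
    Commute ((diagAction N X).rTensor (Fin N → ℂ) + (diagAction N X).lTensor (Fin N → ℂ))
      (ellipticR N τ γ z l) := by
  have hX : ∀ i, diagAction N X (Pi.single i 1) = X i • (Pi.single i 1 : Fin N → ℂ) := by
    intro i
    funext k
    rw [diagAction_apply_apply, Pi.smul_apply, smul_eq_mul]
    by_cases h : k = i
    · rw [h]
    · rw [Pi.single_eq_of_ne h, mul_zero, mul_zero]
  have hw : ∀ i j, ((diagAction N X).rTensor (Fin N → ℂ) + (diagAction N X).lTensor (Fin N → ℂ))
      (basis2 i j) = (X i + X j) • basis2 i j := by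
    intro i j
    simp only [basis2, LinearMap.add_apply, LinearMap.rTensor_tmul, LinearMap.lTensor_tmul, hX,
      TensorProduct.smul_tmul', TensorProduct.tmul_smul, add_smul]
  refine end_ext2 fun i j => ?_
  rw [Module.End.mul_apply, Module.End.mul_apply, hw, ellipticR_basis2, map_add, map_smul, map_smul,
    map_smul, hw, hw, ellipticR_basis2, smul_add, smul_smul, smul_smul, smul_smul, smul_smul,
    add_comm (X j), mul_comm (X i + X j), mul_comm (X i + X j)]

/-! ### The Yang--Baxter equation at generic points -/

section Steps

variable {N : ℕ}

/-- The effect on functionals of `R^{(12)}(z, l + η h^{(3)})`. -/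
def step12 (τ γ z η : ℂ) (l : Fin N → ℂ) (ψ : Fin N → Fin N → Fin N → ℂ) (a b c : Fin N) : ℂ :=
  coefD τ γ z (l + η • Pi.single c 1) a b * ψ a b c
    + coefS τ γ z (l + η • Pi.single c 1) a b * ψ b a c

/-- The effect on functionals of `R^{(13)}(z, l + η h^{(2)})`. -/
def step13 (τ γ z η : ℂ) (l : Fin N → ℂ) (ψ : Fin N → Fin N → Fin N → ℂ) (a b c : Fin N) : ℂ :=
  coefD τ γ z (l + η • Pi.single b 1) a c * ψ a b c
    + coefS τ γ z (l + η • Pi.single b 1) a c * ψ c b a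

/-- The effect on functionals of `R^{(23)}(z, l + η h^{(1)})`. -/
def step23 (τ γ z η : ℂ) (l : Fin N → ℂ) (ψ : Fin N → Fin N → Fin N → ℂ) (a b c : Fin N) : ℂ :=
  coefD τ γ z (l + η • Pi.single a 1) b c * ψ a b c
    + coefS τ γ z (l + η • Pi.single a 1) b c * ψ a c b

theorem coefD_self (τ γ z : ℂ) (l : Fin N → ℂ) (i : Fin N) : coefD τ γ z l i i = 1 := if_pos rfl

theorem coefS_self (τ γ z : ℂ) (l : Fin N → ℂ) (i : Fin N) : coefS τ γ z l i i = 0 := if_pos rfl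

theorem coefD_eq_diagCoef {τ γ z : ℂ} (hτ : 0 < τ.im) (hγ : theta1 τ γ ≠ 0) (hz : theta1 τ z ≠ 0)
    {l : Fin N → ℂ} {i j : Fin N} (hij : i ≠ j) {x : ℂ} (hx : l i - l j = x) :
    coefD τ γ z l i j = diagCoef τ γ z x := by
  have h0 := deriv_theta1_zero_ne_zero hτ
  rw [coefD, if_neg hij, hx, sigma, sigma, diagCoef]
  field_simp

theorem coefS_eq_exchCoef {τ γ z : ℂ} (hτ : 0 < τ.im) (hz : theta1 τ z ≠ 0)
    {l : Fin N → ℂ} {i j : Fin N} (hij : i ≠ j) {x : ℂ} (hx : l i - l j = x) :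
    coefS τ γ z l i j = exchCoef τ γ z x := by
  have h0 := deriv_theta1_zero_ne_zero hτ
  rw [coefS, if_neg hij, show l j - l i = -x by rw [← hx]; ring, sigma, sigma, exchCoef,
    show -x - z = -(x + z) by ring, theta1_neg hτ, theta1_neg hτ]
  field_simp

theorem coefD_shift_left {τ γ z : ℂ} (hτ : 0 < τ.im) (hγ : theta1 τ γ ≠ 0) (η : ℂ) (l : Fin N → ℂ)
    {i j : Fin N} (hz : theta1 τ z ≠ 0) (hij : i ≠ j) :
    coefD τ γ z (l + η • Pi.single i 1) i j = diagCoef τ γ z (l i - l j + η) :=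
  coefD_eq_diagCoef hτ hγ hz hij (by simp [Ne.symm hij]; ring)

theorem coefD_shift_right {τ γ z : ℂ} (hτ : 0 < τ.im) (hγ : theta1 τ γ ≠ 0) (η : ℂ) (l : Fin N → ℂ)
    {i j : Fin N} (hz : theta1 τ z ≠ 0) (hij : i ≠ j) :
    coefD τ γ z (l + η • Pi.single j 1) i j = diagCoef τ γ z (l i - l j - η) :=
  coefD_eq_diagCoef hτ hγ hz hij (by simp [hij]; ring)

theorem coefD_shift_ne {τ γ z : ℂ} (hτ : 0 < τ.im) (hγ : theta1 τ γ ≠ 0) (η : ℂ) (l : Fin N → ℂ)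
    {i j k : Fin N} (hz : theta1 τ z ≠ 0) (hij : i ≠ j) (hik : i ≠ k) (hjk : j ≠ k) :
    coefD τ γ z (l + η • Pi.single k 1) i j = diagCoef τ γ z (l i - l j) :=
  coefD_eq_diagCoef hτ hγ hz hij (by simp [hik, hjk])

theorem coefS_shift_left {τ γ z : ℂ} (hτ : 0 < τ.im) (η : ℂ) (l : Fin N → ℂ)
    {i j : Fin N} (hz : theta1 τ z ≠ 0) (hij : i ≠ j) :
    coefS τ γ z (l + η • Pi.single i 1) i j = exchCoef τ γ z (l i - l j + η) :=
  coefS_eq_exchCoef hτ hz hij (by simp [Ne.symm hij]; ring)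

theorem coefS_shift_right {τ γ z : ℂ} (hτ : 0 < τ.im) (η : ℂ) (l : Fin N → ℂ)
    {i j : Fin N} (hz : theta1 τ z ≠ 0) (hij : i ≠ j) :
    coefS τ γ z (l + η • Pi.single j 1) i j = exchCoef τ γ z (l i - l j - η) :=
  coefS_eq_exchCoef hτ hz hij (by simp [hij]; ring)

theorem coefS_shift_ne {τ γ z : ℂ} (hτ : 0 < τ.im) (η : ℂ) (l : Fin N → ℂ)
    {i j k : Fin N} (hz : theta1 τ z ≠ 0) (hij : i ≠ j) (hik : i ≠ k) (hjk : j ≠ k) :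
    coefS τ γ z (l + η • Pi.single k 1) i j = exchCoef τ γ z (l i - l j) :=
  coefS_eq_exchCoef hτ hz hij (by simp [hik, hjk])

/-- The modified Yang--Baxter equation, paired with a functional with values `ψ` on basis vectors
and applied to `e_a ⊗ e_b ⊗ e_c`. -/
def YangBaxterAt (τ γ u v : ℂ) (l : Fin N → ℂ) (ψ : Fin N → Fin N → Fin N → ℂ)
    (a b c : Fin N) : Prop :=
  step23 τ γ v (γ / 2) l (step13 τ γ (u + v) (-(γ / 2)) l (step12 τ γ u (γ / 2) l ψ)) a b c
    = step12 τ γ u (-(γ / 2)) l (step13 τ γ (u + v) (γ / 2) l (step23 τ γ v (-(γ / 2)) l ψ)) a b c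

/-- No shift is visible here. Of the six permutations, the two 3-cycles use `exch_three_term`,
exchanged by (u,x) ↔ (v,y), the reversal uses `exch_four_term`, the adjacent transpositions use
`diagCoef_mul_comm`, and the identity is immediate. -/
theorem yangBaxterAt_distinct {τ γ u v : ℂ} (hτ : 0 < τ.im) (hγ : theta1 τ γ ≠ 0)
    (hu : theta1 τ u ≠ 0) (hv : theta1 τ v ≠ 0) (hw : theta1 τ (u + v) ≠ 0)
    (hu' : theta1 τ (γ - u) ≠ 0) (hv' : theta1 τ (γ - v) ≠ 0) (hw' : theta1 τ (γ - (u + v)) ≠ 0)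
    {l : Fin N → ℂ} (ψ : Fin N → Fin N → Fin N → ℂ) {a b c : Fin N}
    (hab : a ≠ b) (hbc : b ≠ c) (hac : a ≠ c) (h1 : theta1 τ (l a - l b) ≠ 0)
    (h2 : theta1 τ (l b - l c) ≠ 0) (h3 : theta1 τ (l a - l c) ≠ 0) :
    YangBaxterAt τ γ u v l ψ a b c := by
  obtain ⟨x, hx⟩ : ∃ x, l a - l b = x := ⟨_, rfl⟩
  obtain ⟨y, hy⟩ : ∃ y, l b - l c = y := ⟨_, rfl⟩
  have hxy : l a - l c = x + y := by rw [← hx, ← hy]; ring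
  have hx' : l b - l a = -x := by rw [← hx]; ring
  have hy' : l c - l b = -y := by rw [← hy]; ring
  rw [hx] at h1
  rw [hy] at h2
  rw [hxy] at h3
  have hyx : theta1 τ (y + x) ≠ 0 := by rwa [add_comm]
  have t1 := exch_three_term hτ γ (u := u) (v := v) h1 h2 h3 hu' hv' hw'
  have t2 := exch_three_term hτ γ (u := v) (v := u) h2 h1 hyx hv' hu' (by rwa [add_comm v u])
  have t3 := exch_four_term hτ γ (u := u) (v := v) h1 h2 h3 hu' hv' hw'
  rw [add_comm v u, add_comm y x] at t2
  have c2 := diagCoef_mul_comm τ γ u (u + v) x (x + y)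
  have c3 := diagCoef_mul_comm τ γ v (u + v) y (x + y)
  simp only [YangBaxterAt, step12, step13, step23, coefD_shift_ne hτ hγ, coefS_shift_ne hτ, hu, hv,
    hw, hab, hbc, hac, hab.symm, hbc.symm, hac.symm, ne_eq, not_false_eq_true, hx, hy, hxy, hx', hy']
  linear_combination ψ c a b * t1 - ψ b c a * t2 + ψ c b a * t3
    - exchCoef τ γ v y * ψ a c b * c2 + exchCoef τ γ u x * ψ b a c * c3

/-- A 3×3 block of weight 2e_p + e_q. The arguments x and y below satisfy x + y = γ, so all shifted
differences are ±x or ±y, and the symmetry (u,x) ↔ (v,y) halves the work. -/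
theorem yangBaxterAt_pair {τ γ u v : ℂ} (hτ : 0 < τ.im) (hγ : theta1 τ γ ≠ 0)
    (hu : theta1 τ u ≠ 0) (hv : theta1 τ v ≠ 0) (hw : theta1 τ (u + v) ≠ 0)
    (hu' : theta1 τ (γ - u) ≠ 0) (hv' : theta1 τ (γ - v) ≠ 0) (hw' : theta1 τ (γ - (u + v)) ≠ 0)
    {l : Fin N → ℂ} (ψ : Fin N → Fin N → Fin N → ℂ) {p q : Fin N} (hpq : p ≠ q)
    (h1 : theta1 τ (l p - l q + γ / 2) ≠ 0) (h2 : theta1 τ (l q - l p + γ / 2) ≠ 0) :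
    YangBaxterAt τ γ u v l ψ p p q ∧ YangBaxterAt τ γ u v l ψ p q p ∧
      YangBaxterAt τ γ u v l ψ q p p := by
  obtain ⟨x, hx⟩ : ∃ x, l p - l q + γ / 2 = x := ⟨_, rfl⟩
  obtain ⟨y, hy⟩ : ∃ y, l q - l p + γ / 2 = y := ⟨_, rfl⟩
  have e1 : x - γ = -y := by rw [← hx, ← hy]; ring
  have e2 : y - γ = -x := by rw [← hx, ← hy]; ring
  have a1 : l p - l q - γ / 2 = -y := by rw [← hy]; ring
  have a2 : l q - l p - γ / 2 = -x := by rw [← hx]; ring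
  rw [hx] at h1
  rw [hy] at h2
  have h1' : theta1 τ (x - γ) ≠ 0 := by rwa [e1, theta1_neg hτ, neg_ne_zero]
  have h2' : theta1 τ (y - γ) ≠ 0 := by rwa [e2, theta1_neg hτ, neg_ne_zero]
  have hvu' : theta1 τ (γ - (v + u)) ≠ 0 := by rwa [add_comm v u]
  have j1 := double_exch hτ γ h1 h1' hu' hv' hw'
  have j2 := mixed_exch_left hτ γ h1 h1' hu' hv' hw'
  have j3 := exch_middle hτ γ h1 h1' hu' hv' hw'
  have j4 := mixed_exch_right hτ γ h1 h1' hu' hv' hw'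
  have j5 := mixed_exch_right hτ γ h2 h2' hv' hu' hvu'
  have j6 := double_exch hτ γ h2 h2' hv' hu' hvu'
  have j7 := mixed_exch_left hτ γ h2 h2' hv' hu' hvu'
  simp only [e1, e2, add_comm v u, neg_neg] at j1 j2 j3 j4 j5 j6 j7
  have c1 := diagCoef_mul_comm τ γ v (u + v) x (-y)
  have c2 := diagCoef_mul_comm τ γ u (u + v) y (-x)
  simp only [YangBaxterAt, step12, step13, step23, coefD_self, coefS_self, coefD_shift_left hτ hγ,
    coefD_shift_right hτ hγ, coefS_shift_left hτ, coefS_shift_right hτ, hu, hv,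
    hw, hpq, hpq.symm, ne_eq, not_false_eq_true, ← sub_eq_add_neg, sub_neg_eq_add, hx, hy, a1, a2]
  refine ⟨?_, ?_, ?_⟩
  · linear_combination ψ q p p * j1 + ψ p q p * j2 + ψ p p q * c1
  · linear_combination ψ p q p * j3 + ψ q p p * j4 - ψ p p q * j5
  · linear_combination -ψ p p q * j6 - ψ p q p * j7 - ψ q p p * c2

theorem yangBaxterAt_generic {τ γ u v : ℂ} (hτ : 0 < τ.im) (hγ : theta1 τ γ ≠ 0)
    (hu : theta1 τ u ≠ 0) (hv : theta1 τ v ≠ 0) (hw : theta1 τ (u + v) ≠ 0)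
    (hu' : theta1 τ (γ - u) ≠ 0) (hv' : theta1 τ (γ - v) ≠ 0) (hw' : theta1 τ (γ - (u + v)) ≠ 0)
    {l : Fin N → ℂ} (hl : ∀ i j, i ≠ j → theta1 τ (l i - l j) ≠ 0 ∧
      theta1 τ (l i - l j + γ / 2) ≠ 0) (ψ : Fin N → Fin N → Fin N → ℂ) (a b c : Fin N) :
    YangBaxterAt τ γ u v l ψ a b c := by
  have hpair : ∀ {p q : Fin N}, p ≠ q → _ := fun {p q} hpq =>
    yangBaxterAt_pair hτ hγ hu hv hw hu' hv' hw' ψ hpq (hl p q hpq).2 (hl q p hpq.symm).2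
  by_cases hab : a = b
  · subst hab
    by_cases hac : a = c
    · subst hac
      simp only [YangBaxterAt, step12, step13, step23, coefD_self, coefS_self]
    · exact (hpair hac).1
  · by_cases hac : a = c
    · subst hac
      exact (hpair hab).2.1
    · by_cases hbc : b = c
      · subst hbc
        exact (hpair (Ne.symm hab)).2.2
      · exact yangBaxterAt_distinct hτ hγ hu hv hw hu' hv' hw' ψ hab hbc hac (hl a b hab).1
          (hl b c hbc).1 (hl a c hac).1

end Steps

/-! ### Passage to all regular points -/

section Limits

variable {N : ℕ}

theorem exists_dual_basis2 (i j : Fin N) :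
    ∃ f : Module.Dual ℂ ((Fin N → ℂ) ⊗[ℂ] (Fin N → ℂ)),
      ∀ a b, f (basis2 a b) = if a = i ∧ b = j then 1 else 0 := by
  refine ⟨((Pi.basisFun ℂ (Fin N)).tensorProduct (Pi.basisFun ℂ (Fin N))).coord (i, j),
    fun a b => ?_⟩
  have h : (basis2 a b : (Fin N → ℂ) ⊗[ℂ] (Fin N → ℂ)) =
      (Pi.basisFun ℂ (Fin N)).tensorProduct (Pi.basisFun ℂ (Fin N)) (a, b) := by
    simp [basis2]
  rw [h, Module.Basis.coord_apply, Module.Basis.repr_self, Finsupp.single_apply]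
  simp only [Prod.mk.injEq]

/-- Regularity concerns the total function, default values of division included. Hence the value of
a coefficient at a regular point is the limit of its generic values. -/
theorem continuousAt_coef {τ γ z : ℂ} {l : Fin N → ℂ}
    (h : IsRegularAt (ellipticR N τ γ) z l) (i j : Fin N) :
    ContinuousAt (fun p : ℂ × (Fin N → ℂ) => coefD τ γ p.1 p.2 i j) (z, l) ∧
      ContinuousAt (fun p : ℂ × (Fin N → ℂ) => coefS τ γ p.1 p.2 i j) (z, l) := by
  by_cases hij : i = j
  · subst hij
    simp only [coefD_self, coefS_self]
    exact ⟨continuousAt_const, continuousAt_const⟩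
  · obtain ⟨f, hf⟩ := exists_dual_basis2 i j
    obtain ⟨g, hg⟩ := exists_dual_basis2 j i
    have h1 := (h (f ∘ₗ LinearMap.applyₗ (basis2 i j))).continuousAt
    have h2 := (h (g ∘ₗ LinearMap.applyₗ (basis2 i j))).continuousAt
    simp only [LinearMap.comp_apply, LinearMap.applyₗ_apply_apply, ellipticR_basis2, map_add,
      map_smul, hf, hg, hij, Ne.symm hij, and_self, if_true, if_false, smul_eq_mul, mul_one,
      mul_zero, add_zero, zero_add] at h1 h2
    exact ⟨h1, h2⟩

variable {τ γ η z₀ : ℂ} {F : Filter ℂ} {z : ℂ → ℂ} {m : ℂ → Fin N → ℂ} {m₀ : Fin N → ℂ}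

theorem tendsto_coefD (hz : Filter.Tendsto z F (𝓝 z₀)) (hm : Filter.Tendsto m F (𝓝 m₀))
    (hR : IsRegularAt (ellipticR N τ γ) z₀ m₀) (i j : Fin N) :
    Filter.Tendsto (fun t => coefD τ γ (z t) (m t) i j) F (𝓝 (coefD τ γ z₀ m₀ i j)) := by
  have h := (continuousAt_coef hR i j).1
  have hp := hz.prodMk_nhds hm
  have hc := Filter.Tendsto.comp h hp
  exact hc

theorem tendsto_coefS (hz : Filter.Tendsto z F (𝓝 z₀)) (hm : Filter.Tendsto m F (𝓝 m₀))
    (hR : IsRegularAt (ellipticR N τ γ) z₀ m₀) (i j : Fin N) :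
    Filter.Tendsto (fun t => coefS τ γ (z t) (m t) i j) F (𝓝 (coefS τ γ z₀ m₀ i j)) := by
  have h := (continuousAt_coef hR i j).2
  have hp := hz.prodMk_nhds hm
  have hc := Filter.Tendsto.comp h hp
  exact hc

variable {ψ : ℂ → Fin N → Fin N → Fin N → ℂ} {ψ₀ : Fin N → Fin N → Fin N → ℂ}

theorem tendsto_step12 (hz : Filter.Tendsto z F (𝓝 z₀)) (hm : Filter.Tendsto m F (𝓝 m₀))
    (hR : ∀ k, IsRegularAt (ellipticR N τ γ) z₀ (m₀ + η • Pi.single k 1))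
    (hψ : ∀ a b c, Filter.Tendsto (fun t => ψ t a b c) F (𝓝 (ψ₀ a b c))) (a b c : Fin N) :
    Filter.Tendsto (fun t => step12 τ γ (z t) η (m t) (ψ t) a b c) F
      (𝓝 (step12 τ γ z₀ η m₀ ψ₀ a b c)) :=
  ((tendsto_coefD hz (hm.add_const _) (hR _) _ _).mul (hψ _ _ _)).add
    ((tendsto_coefS hz (hm.add_const _) (hR _) _ _).mul (hψ _ _ _))

theorem tendsto_step13 (hz : Filter.Tendsto z F (𝓝 z₀)) (hm : Filter.Tendsto m F (𝓝 m₀))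
    (hR : ∀ k, IsRegularAt (ellipticR N τ γ) z₀ (m₀ + η • Pi.single k 1))
    (hψ : ∀ a b c, Filter.Tendsto (fun t => ψ t a b c) F (𝓝 (ψ₀ a b c))) (a b c : Fin N) :
    Filter.Tendsto (fun t => step13 τ γ (z t) η (m t) (ψ t) a b c) F
      (𝓝 (step13 τ γ z₀ η m₀ ψ₀ a b c)) :=
  ((tendsto_coefD hz (hm.add_const _) (hR _) _ _).mul (hψ _ _ _)).add
    ((tendsto_coefS hz (hm.add_const _) (hR _) _ _).mul (hψ _ _ _))

theorem tendsto_step23 (hz : Filter.Tendsto z F (𝓝 z₀)) (hm : Filter.Tendsto m F (𝓝 m₀))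
    (hR : ∀ k, IsRegularAt (ellipticR N τ γ) z₀ (m₀ + η • Pi.single k 1))
    (hψ : ∀ a b c, Filter.Tendsto (fun t => ψ t a b c) F (𝓝 (ψ₀ a b c))) (a b c : Fin N) :
    Filter.Tendsto (fun t => step23 τ γ (z t) η (m t) (ψ t) a b c) F
      (𝓝 (step23 τ γ z₀ η m₀ ψ₀ a b c)) :=
  ((tendsto_coefD hz (hm.add_const _) (hR _) _ _).mul (hψ _ _ _)).add
    ((tendsto_coefS hz (hm.add_const _) (hR _) _ _).mul (hψ _ _ _))

/-- A line through `l` along which all differences of coordinates vary. -/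
def spread (l : Fin N → ℂ) (t : ℂ) : Fin N → ℂ := fun i => l i + (i : ℕ) * t

theorem tendsto_spread (l : Fin N → ℂ) : Filter.Tendsto (spread l) (𝓝[≠] 0) (𝓝 l) := by
  have h : Continuous (spread l) := by unfold spread; fun_prop
  have h2 := h.tendsto 0
  have h3 : spread l 0 = l := by funext i; simp [spread]
  rw [h3] at h2
  exact h2.mono_left nhdsWithin_le_nhds

theorem tendsto_add_mul (z k : ℂ) :
    Filter.Tendsto (fun t : ℂ => z + k * t) (𝓝[≠] 0) (𝓝 z) := by
  have h : Continuous (fun t : ℂ => z + k * t) := by fun_prop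
  have h2 := h.tendsto 0
  rw [mul_zero, add_zero] at h2
  exact h2.mono_left nhdsWithin_le_nhds

theorem eventually_spread_ne_zero (hτ : 0 < τ.im) (l : Fin N → ℂ) (s : ℂ) :
    ∀ᶠ t in 𝓝[≠] (0 : ℂ), ∀ i j, i ≠ j → theta1 τ (spread l t i - spread l t j + s) ≠ 0 := by
  simp only [Filter.eventually_all]
  intro i j hij
  have hk : ((i : ℕ) : ℂ) - ((j : ℕ) : ℂ) ≠ 0 := by
    rw [sub_ne_zero, Ne, Nat.cast_inj]
    exact fun h => hij (Fin.ext h)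
  filter_upwards [theta1_eventually_ne_zero hτ (l i - l j + s) hk 0] with t ht
  convert ht using 2
  simp only [spread]
  ring

/-- Move u and v to u + t and v + t, and l along `spread`. For small t ≠ 0 the point is generic, and
both sides converge as t tends to 0. -/
theorem yangBaxterAt_regular (hτ : 0 < τ.im) (hγ : theta1 τ γ ≠ 0) {u v : ℂ} {l : Fin N → ℂ}
    (hu : ∀ k, IsRegularAt (ellipticR N τ γ) u (l + (γ / 2) • Pi.single k 1) ∧
      IsRegularAt (ellipticR N τ γ) u (l + (-(γ / 2)) • Pi.single k 1))
    (hv : ∀ k, IsRegularAt (ellipticR N τ γ) v (l + (γ / 2) • Pi.single k 1) ∧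
      IsRegularAt (ellipticR N τ γ) v (l + (-(γ / 2)) • Pi.single k 1))
    (hw : ∀ k, IsRegularAt (ellipticR N τ γ) (u + v) (l + (γ / 2) • Pi.single k 1) ∧
      IsRegularAt (ellipticR N τ γ) (u + v) (l + (-(γ / 2)) • Pi.single k 1))
    (ψ : Fin N → Fin N → Fin N → ℂ) (a b c : Fin N) : YangBaxterAt τ γ u v l ψ a b c := by
  have tu := tendsto_add_mul u 1
  have tv := tendsto_add_mul v 1
  have tw := tu.add tv
  have tl := tendsto_spread l
  have hL := tendsto_step23 tv tl (fun k => (hv k).1) (tendsto_step13 tw tl (fun k => (hw k).2)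
    (tendsto_step12 tu tl (fun k => (hu k).1) (ψ := fun _ => ψ)
      (fun a b c => tendsto_const_nhds))) a b c
  have hR := tendsto_step12 tu tl (fun k => (hu k).2) (tendsto_step13 tw tl (fun k => (hw k).1)
    (tendsto_step23 tv tl (fun k => (hv k).2) (ψ := fun _ => ψ)
      (fun a b c => tendsto_const_nhds))) a b c
  refine tendsto_nhds_unique_of_eventuallyEq hL hR ?_
  filter_upwards [theta1_eventually_ne_zero hτ u one_ne_zero 0,
    theta1_eventually_ne_zero hτ v one_ne_zero 0,
    -- The slope is 2 because u and v both move by t.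
    theta1_eventually_ne_zero hτ (u + v) two_ne_zero 0,
    theta1_eventually_ne_zero hτ (γ - u) (neg_ne_zero.2 one_ne_zero) 0,
    theta1_eventually_ne_zero hτ (γ - v) (neg_ne_zero.2 one_ne_zero) 0,
    theta1_eventually_ne_zero hτ (γ - (u + v)) (neg_ne_zero.2 two_ne_zero) 0,
    eventually_spread_ne_zero hτ l 0, eventually_spread_ne_zero hτ l (γ / 2)]
    with t h1 h2 h3 h4 h5 h6 h7 h8
  refine yangBaxterAt_generic hτ hγ h1 h2 ?_ ?_ ?_ ?_ (fun i j hij => ⟨?_, h8 i j hij⟩) ψ a b c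
  · convert h3 using 2; ring
  · convert h4 using 2; ring
  · convert h5 using 2; ring
  · convert h6 using 2; ring
  · simpa only [add_zero] using h7 i j hij

theorem unitarity_regular (hτ : 0 < τ.im) (hγ : theta1 τ γ ≠ 0) {z : ℂ} {l : Fin N → ℂ}
    (h1 : IsRegularAt (ellipticR N τ γ) z l) (h2 : IsRegularAt (ellipticR N τ γ) (-z) l)
    {i j : Fin N} (hij : i ≠ j) :
    coefD τ γ (-z) l j i * coefD τ γ z l i j + coefS τ γ (-z) l j i * coefS τ γ z l j i = 1 ∧
      coefD τ γ (-z) l j i * coefS τ γ z l i j + coefS τ γ (-z) l j i * coefD τ γ z l j i = 0 := by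
  have tz := tendsto_add_mul z 1
  have tl := tendsto_spread l
  have key : ∀ᶠ t in 𝓝[≠] (0 : ℂ), ∀ w m, w = z + 1 * t → m = spread l t →
      coefD τ γ (-w) m j i * coefD τ γ w m i j + coefS τ γ (-w) m j i * coefS τ γ w m j i = 1 ∧
      coefD τ γ (-w) m j i * coefS τ γ w m i j + coefS τ γ (-w) m j i * coefD τ γ w m j i = 0 := by
    filter_upwards [theta1_eventually_ne_zero hτ z one_ne_zero 0,
      theta1_eventually_ne_zero hτ (γ - z) (neg_ne_zero.2 one_ne_zero) 0,
      theta1_eventually_ne_zero hτ (γ + z) one_ne_zero 0, eventually_spread_ne_zero hτ l 0]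
      with t h1 h2 h3 h4 w m hw hm
    rw [show γ - z + -1 * t = γ - w by rw [hw]; ring] at h2
    rw [show γ + z + 1 * t = γ + w by rw [hw]; ring] at h3
    rw [← hw] at h1
    have h1' : theta1 τ (-w) ≠ 0 := by rwa [theta1_neg hτ, neg_ne_zero]
    have hx := h4 i j hij
    rw [← hm, add_zero] at hx
    have hji : m j - m i = -(m i - m j) := by ring
    rw [coefD_eq_diagCoef hτ hγ h1' hij.symm hji, coefD_eq_diagCoef hτ hγ h1 hij rfl,
      coefS_eq_exchCoef hτ h1' hij.symm hji, coefS_eq_exchCoef hτ h1 hij.symm hji,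
      coefS_eq_exchCoef hτ h1 hij rfl, coefD_eq_diagCoef hτ hγ h1 hij.symm hji]
    exact ⟨unitarity_diag hτ γ hx h2 h3, unitarity_exch hτ γ _ _⟩
  constructor
  · refine tendsto_nhds_unique_of_eventuallyEq
      (((tendsto_coefD tz.neg tl h2 j i).mul (tendsto_coefD tz tl h1 i j)).add
      ((tendsto_coefS tz.neg tl h2 j i).mul (tendsto_coefS tz tl h1 j i))) tendsto_const_nhds ?_
    filter_upwards [key] with t ht using (ht _ _ rfl rfl).1
  · refine tendsto_nhds_unique_of_eventuallyEq
      (((tendsto_coefD tz.neg tl h2 j i).mul (tendsto_coefS tz tl h1 i j)).add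
      ((tendsto_coefS tz.neg tl h2 j i).mul (tendsto_coefD tz tl h1 j i))) tendsto_const_nhds ?_
    filter_upwards [key] with t ht using (ht _ _ rfl rfl).2

end Limits

/-! ### Meromorphy -/

section Meromorphy

variable {N : ℕ} {τ γ : ℂ}

theorem analyticAt_theta1_comp {E : Type*} [NormedAddCommGroup E] [NormedSpace ℂ E]
    (hτ : 0 < τ.im) {f : E → ℂ} {p : E} (hf : AnalyticAt ℂ f p) :
    AnalyticAt ℂ (fun x => theta1 τ (f x)) p :=
  ((differentiable_theta1 hτ).analyticAt (f p)).fun_comp hf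

theorem analyticAt_coord_sub (i j : Fin N) (p : ℂ × (Fin N → ℂ)) :
    AnalyticAt ℂ (fun p : ℂ × (Fin N → ℂ) => p.2 i - p.2 j) p :=
  (((ContinuousLinearMap.proj i : (Fin N → ℂ) →L[ℂ] ℂ) -
    (ContinuousLinearMap.proj j : (Fin N → ℂ) →L[ℂ] ℂ)).comp
      (ContinuousLinearMap.snd ℂ ℂ (Fin N → ℂ))).analyticAt p

/-- The product of the factors of `commonDenom` over a set of index pairs. -/
def pairDenom (τ : ℂ) (s : Finset (Fin N × Fin N)) (p : ℂ × (Fin N → ℂ)) : ℂ :=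
  ∏ e ∈ s, theta1 τ (p.2 e.1 - p.2 e.2)

/-- A common denominator of the matrix elements of the elliptic R-matrix. -/
def commonDenom (N : ℕ) (τ γ : ℂ) (p : ℂ × (Fin N → ℂ)) : ℂ :=
  theta1 τ p.1 * theta1 τ (γ - p.1) * pairDenom τ (Finset.univ.filter fun e => e.1 ≠ e.2) p

theorem analyticAt_pairDenom (hτ : 0 < τ.im) (s : Finset (Fin N × Fin N))
    (p : ℂ × (Fin N → ℂ)) : AnalyticAt ℂ (pairDenom τ s) p :=
  Finset.analyticAt_fun_prod s fun e _ =>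
    analyticAt_theta1_comp hτ (analyticAt_coord_sub e.1 e.2 p)

theorem analyticAt_commonDenom (hτ : 0 < τ.im) (p : ℂ × (Fin N → ℂ)) :
    AnalyticAt ℂ (commonDenom N τ γ) p :=
  ((analyticAt_theta1_comp hτ analyticAt_fst).mul
    (analyticAt_theta1_comp hτ (analyticAt_const.sub analyticAt_fst))).mul
    (analyticAt_pairDenom hτ _ p)

theorem frequently_commonDenom_ne_zero (hτ : 0 < τ.im) (p : ℂ × (Fin N → ℂ)) :
    ∃ᶠ x in 𝓝 p, commonDenom N τ γ x ≠ 0 := by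
  have ht : Filter.Tendsto (fun t => (p.1 + 1 * t, spread p.2 t)) (𝓝[≠] (0 : ℂ)) (𝓝 p) :=
    (tendsto_add_mul p.1 1).prodMk_nhds (tendsto_spread p.2)
  refine ht.frequently (Filter.Eventually.frequently ?_)
  filter_upwards [theta1_eventually_ne_zero hτ p.1 one_ne_zero 0,
    theta1_eventually_ne_zero hτ (γ - p.1) (neg_ne_zero.2 one_ne_zero) 0,
    eventually_spread_ne_zero hτ p.2 0] with t h1 h2 h3
  refine mul_ne_zero (mul_ne_zero h1 ?_) (Finset.prod_ne_zero_iff.2 fun e he => ?_)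
  · convert h2 using 2; ring
  · simpa only [add_zero] using h3 e.1 e.2 (Finset.mem_filter.1 he).2

/-- `F` is the quotient of an entire function by the common denominator. -/
def IsQuotient (τ γ : ℂ) (F : ℂ × (Fin N → ℂ) → ℂ) : Prop :=
  ∃ f : ℂ × (Fin N → ℂ) → ℂ, (∀ p, AnalyticAt ℂ f p) ∧
    ∀ p, commonDenom N τ γ p ≠ 0 → F p = f p / commonDenom N τ γ p

theorem IsQuotient.isMeromorphic (hτ : 0 < τ.im) {F : ℂ × (Fin N → ℂ) → ℂ}
    (h : IsQuotient τ γ F) : IsMeromorphic F := by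
  obtain ⟨f, hf, hF⟩ := h
  exact fun p => ⟨f, _, hf p, analyticAt_commonDenom hτ p, frequently_commonDenom_ne_zero hτ p,
    Filter.Eventually.of_forall hF⟩

theorem IsQuotient.add {F G : ℂ × (Fin N → ℂ) → ℂ} (hF : IsQuotient τ γ F)
    (hG : IsQuotient τ γ G) : IsQuotient τ γ (fun p => F p + G p) := by
  obtain ⟨f, hf, hF⟩ := hF
  obtain ⟨g, hg, hG⟩ := hG
  exact ⟨fun p => f p + g p, fun p => (hf p).add (hg p), fun p hp => by
    dsimp only
    rw [hF p hp, hG p hp, add_div]⟩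

theorem IsQuotient.mul_const {F : ℂ × (Fin N → ℂ) → ℂ} (hF : IsQuotient τ γ F) (c : ℂ) :
    IsQuotient τ γ (fun p => F p * c) := by
  obtain ⟨f, hf, hF⟩ := hF
  exact ⟨fun p => f p * c, fun p => (hf p).mul analyticAt_const, fun p hp => by
    dsimp only
    rw [hF p hp, div_mul_eq_mul_div]⟩

theorem isQuotient_const (hτ : 0 < τ.im) (c : ℂ) :
    IsQuotient τ γ (fun _ : ℂ × (Fin N → ℂ) => c) :=
  ⟨fun p => c * commonDenom N τ γ p, fun p => analyticAt_const.mul (analyticAt_commonDenom hτ p),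
    fun _ hp => (mul_div_cancel_right₀ c hp).symm⟩

theorem isQuotient_sum (hτ : 0 < τ.im) {ι : Type*} (s : Finset ι)
    {F : ι → ℂ × (Fin N → ℂ) → ℂ} (h : ∀ i ∈ s, IsQuotient τ γ (F i)) :
    IsQuotient τ γ (fun p => ∑ i ∈ s, F i p) := by
  classical
  induction s using Finset.induction_on with
  | empty => simpa using isQuotient_const hτ 0
  | insert a s ha ih =>
    simp only [Finset.sum_insert ha]
    exact (h a (Finset.mem_insert_self a s)).add
      (ih fun i hi => h i (Finset.mem_insert_of_mem hi))

theorem commonDenom_eq {i j : Fin N} (hij : i ≠ j) (p : ℂ × (Fin N → ℂ)) :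
    commonDenom N τ γ p = theta1 τ p.1 * theta1 τ (γ - p.1) * (theta1 τ (p.2 i - p.2 j) *
      pairDenom τ ((Finset.univ.filter fun e => e.1 ≠ e.2).erase (i, j)) p) := by
  rw [commonDenom, pairDenom, pairDenom, ← Finset.mul_prod_erase _ _
    (Finset.mem_filter.2 ⟨Finset.mem_univ (i, j), hij⟩)]

theorem isQuotient_diag (hτ : 0 < τ.im) (hγ : theta1 τ γ ≠ 0) {i j : Fin N} (hij : i ≠ j) :
    IsQuotient τ γ (fun p : ℂ × (Fin N → ℂ) =>
      sigma τ γ (p.2 i - p.2 j) / sigma τ γ p.1) := by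
  have h0 := deriv_theta1_zero_ne_zero hτ
  -- One factor θ₁(z) belongs to the coefficient; the other cancels the θ₁(z) of `commonDenom`,
  -- which excludes points where σ(γ,z) has the default value 0.
  refine ⟨fun p => theta1 τ (γ - (p.2 i - p.2 j)) * theta1 τ p.1 * theta1 τ p.1 *
    pairDenom τ ((Finset.univ.filter fun e => e.1 ≠ e.2).erase (i, j)) p, fun p => ?_,
    fun p hp => ?_⟩
  · exact (((analyticAt_theta1_comp hτ (analyticAt_const.sub (analyticAt_coord_sub i j p))).mul
      (analyticAt_theta1_comp hτ analyticAt_fst)).mul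
      (analyticAt_theta1_comp hτ analyticAt_fst)).mul (analyticAt_pairDenom hτ _ p)
  · rw [commonDenom_eq hij] at hp ⊢
    simp only [mul_ne_zero_iff] at hp
    obtain ⟨⟨h1, h2⟩, h3, h4⟩ := hp
    simp only [sigma]
    field_simp

theorem isQuotient_exch (hτ : 0 < τ.im) (hγ : theta1 τ γ ≠ 0) {i j : Fin N} (hij : i ≠ j) :
    IsQuotient τ γ (fun p : ℂ × (Fin N → ℂ) =>
      sigma τ (p.2 i - p.2 j) p.1 / sigma τ γ p.1) := by
  have h0 := deriv_theta1_zero_ne_zero hτ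
  refine ⟨fun p => theta1 τ (p.2 i - p.2 j - p.1) * theta1 τ γ * theta1 τ p.1 *
    pairDenom τ ((Finset.univ.filter fun e => e.1 ≠ e.2).erase (i, j)) p, fun p => ?_,
    fun p hp => ?_⟩
  · exact (((analyticAt_theta1_comp hτ ((analyticAt_coord_sub i j p).sub analyticAt_fst)).mul
      analyticAt_const).mul (analyticAt_theta1_comp hτ analyticAt_fst)).mul
      (analyticAt_pairDenom hτ _ p)
  · rw [commonDenom_eq hij] at hp ⊢
    simp only [mul_ne_zero_iff] at hp
    obtain ⟨⟨h1, h2⟩, h3, h4⟩ := hp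
    simp only [sigma]
    field_simp

theorem isMeromorphic_ellipticR (hτ : 0 < τ.im) (hγ : theta1 τ γ ≠ 0)
    (φ : Module.Dual ℂ (Module.End ℂ ((Fin N → ℂ) ⊗[ℂ] (Fin N → ℂ)))) :
    IsMeromorphic (fun p : ℂ × (Fin N → ℂ) => φ (ellipticR N τ γ p.1 p.2)) := by
  apply IsQuotient.isMeromorphic (τ := τ) (γ := γ) hτ
  simp only [ellipticR, map_add, map_sum, map_smul, smul_eq_mul]
  refine ((isQuotient_const hτ _).add ?_).add ?_
  · exact isQuotient_sum hτ _ fun i _ => isQuotient_sum hτ _ fun j hj =>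
      (isQuotient_diag hτ hγ (Finset.mem_filter.1 hj).2).mul_const _
  · exact isQuotient_sum hτ _ fun i _ => isQuotient_sum hτ _ fun j hj =>
      (isQuotient_exch hτ hγ (Finset.mem_filter.1 hj).2).mul_const _

end Meromorphy

/-! ### Pairing the Yang–Baxter equation with linear functionals -/

theorem dual_comp_eq_step {N : ℕ} {τ γ z η : ℂ} {l : Fin N → ℂ}
    (ψ : Module.Dual ℂ ((Fin N → ℂ) ⊗[ℂ] ((Fin N → ℂ) ⊗[ℂ] (Fin N → ℂ)))) :
    (fun a b c => ψ (dynShift (diagTraceForm N) (diagAction N) op3 η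
      (fun m => leg12 (ellipticR N τ γ z m)) l (basis3 a b c)))
        = step12 τ γ z η l (fun a b c => ψ (basis3 a b c)) ∧
    (fun a b c => ψ (dynShift (diagTraceForm N) (diagAction N) op2 η
      (fun m => leg13 (ellipticR N τ γ z m)) l (basis3 a b c)))
        = step13 τ γ z η l (fun a b c => ψ (basis3 a b c)) ∧
    (fun a b c => ψ (dynShift (diagTraceForm N) (diagAction N) op1 η
      (fun m => leg23 (ellipticR N τ γ z m)) l (basis3 a b c)))
        = step23 τ γ z η l (fun a b c => ψ (basis3 a b c)) := by
  refine ⟨?_, ?_, ?_⟩ <;> funext a b c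
  · rw [dynShift_leg12_basis3, map_add, map_smul, map_smul]; rfl
  · rw [dynShift_leg13_basis3, map_add, map_smul, map_smul]; rfl
  · rw [dynShift_leg23_basis3, map_add, map_smul, map_smul]; rfl

/-- Pulling back functionals reverses composition: the operator that acts first on the vector
becomes the outermost step. -/
theorem dual_left_eq_step {N : ℕ} {τ γ u v w η η' : ℂ} {l : Fin N → ℂ}
    (ψ : Module.Dual ℂ ((Fin N → ℂ) ⊗[ℂ] ((Fin N → ℂ) ⊗[ℂ] (Fin N → ℂ)))) (a b c : Fin N) :
    ψ ((dynShift (diagTraceForm N) (diagAction N) op3 η (fun m => leg12 (ellipticR N τ γ u m)) l *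
      dynShift (diagTraceForm N) (diagAction N) op2 η' (fun m => leg13 (ellipticR N τ γ w m)) l *
      dynShift (diagTraceForm N) (diagAction N) op1 η (fun m => leg23 (ellipticR N τ γ v m)) l)
        (basis3 a b c)) =
    step23 τ γ v η l (step13 τ γ w η' l (step12 τ γ u η l (fun a b c => ψ (basis3 a b c)))) a b c := by
  rw [← (dual_comp_eq_step ψ).1]
  exact (congrFun (congrFun (congrFun (dual_comp_eq_step (ψ ∘ₗ _ ∘ₗ _)).2.2 a) b) c).trans
    (congrArg (fun f => step23 τ γ v η l f a b c) (dual_comp_eq_step (ψ ∘ₗ _)).2.1)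

theorem dual_right_eq_step {N : ℕ} {τ γ u v w η η' : ℂ} {l : Fin N → ℂ}
    (ψ : Module.Dual ℂ ((Fin N → ℂ) ⊗[ℂ] ((Fin N → ℂ) ⊗[ℂ] (Fin N → ℂ)))) (a b c : Fin N) :
    ψ ((dynShift (diagTraceForm N) (diagAction N) op1 η (fun m => leg23 (ellipticR N τ γ v m)) l *
      dynShift (diagTraceForm N) (diagAction N) op2 η' (fun m => leg13 (ellipticR N τ γ w m)) l *
      dynShift (diagTraceForm N) (diagAction N) op3 η (fun m => leg12 (ellipticR N τ γ u m)) l)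
        (basis3 a b c)) =
    step12 τ γ u η l (step13 τ γ w η' l (step23 τ γ v η l (fun a b c => ψ (basis3 a b c)))) a b c := by
  rw [← (dual_comp_eq_step ψ).2.2]
  exact (congrFun (congrFun (congrFun (dual_comp_eq_step (ψ ∘ₗ _ ∘ₗ _)).1 a) b) c).trans
    (congrArg (fun f => step12 τ γ u η l f a b c) (dual_comp_eq_step (ψ ∘ₗ _)).2.1)

end EllipticR

end

open EllipticR in
theorem mainTheorem1 (N : ℕ) (τ γ : ℂ) (hτ : 0 < τ.im)
    (hγ : ∀ m n : ℤ, γ ≠ (m : ℂ) + (n : ℂ) * τ) :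
    EllipticR.IsGeneralizedQuantumRMatrix (EllipticR.diagTraceForm N) (EllipticR.diagAction N)
      (γ / 2) (EllipticR.ellipticR N τ γ) := by
  have hγ' : theta1 τ γ ≠ 0 := fun h =>
    let ⟨m, n, hmn⟩ := theta1_eq_zero hτ h
    hγ m n hmn
  refine ⟨inferInstance, inferInstance, ⟨fun a b => ?_⟩, ⟨fun a ha => ?_, fun a ha => ?_⟩,
    iSup_weightSpace N, isMeromorphic_ellipticR hτ hγ', fun z₁ z₂ z₃ l h => ?_,
    fun z₁ z₂ l h1 h2 => ?_, fun X z l _ => commute_weight_ellipticR τ γ z l X⟩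
  · simp only [diagTraceForm_eq_sum]
    exact Finset.sum_congr rfl fun i _ => mul_comm _ _
  · funext i
    have := ha (Pi.single i 1)
    rw [diagTraceForm_eq_sum] at this
    simpa [Pi.single_apply] using this
  · funext i
    have := ha (Pi.single i 1)
    rw [diagTraceForm_eq_sum] at this
    simpa [Pi.single_apply] using this
  · have hw : z₁ - z₃ = (z₁ - z₂) + (z₂ - z₃) := by ring
    rw [hw] at h ⊢
    have hreg := fun k => h (Pi.single k 1) (weightSpace_single_ne_bot N k)
    refine end_ext3 fun a b c => ?_
    rw [← sub_eq_zero, ← Module.forall_dual_apply_eq_zero_iff ℂ]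
    intro ψ
    rw [map_sub, sub_eq_zero]
    have key := yangBaxterAt_regular hτ hγ' (fun k => hreg k _ (Or.inl rfl))
      (fun k => hreg k _ (Or.inr (Or.inr rfl))) (fun k => hreg k _ (Or.inr (Or.inl rfl)))
      (fun a b c => ψ (basis3 a b c)) a b c
    rw [dual_left_eq_step, dual_right_eq_step]
    exact key
  · rw [show z₂ - z₁ = -(z₁ - z₂) by ring] at h2 ⊢
    refine end_ext2 fun i j => ?_
    rw [Module.End.mul_apply, leg21_ellipticR_basis2, map_add, map_smul, map_smul,
      ellipticR_basis2, ellipticR_basis2, Module.End.one_apply]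
    by_cases hij : i = j
    · subst hij
      simp [coefD_self, coefS_self]
    · obtain ⟨e1, e2⟩ := unitarity_regular hτ hγ' h1 h2 hij
      -- On the span of e_i ⊗ e_j and e_j ⊗ e_i, unitarity amounts to two scalar equations.
      have : ∀ (a b c d e f : ℂ) (x y : (Fin N → ℂ) ⊗[ℂ] (Fin N → ℂ)),
          a * b + d * f = 1 → a * c + d * e = 0 →
          a • (b • x + c • y) + d • (e • y + f • x) = x := by
        intro a b c d e f x y h1 h2
        rw [show a • (b • x + c • y) + d • (e • y + f • x) =
          (a * b + d * f) • x + (a * c + d * e) • y by module, h1, h2, one_smul, zero_smul, add_zero]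
      exact this _ _ _ _ _ _ _ _ e1 e2
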